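/- Let $G$ be a locally compact, second-countable (Hausdorff) amenable group with a left Haar measure $\mathrm{m}$, let $\Gamma$ be a countable dense subgroup of $G$, and let $(\Phi_N)$ be a left Følner sequence in $G$: compact sets of positive measure with $\mathrm{m}(\Phi_N \,\triangle\, g\Phi_N)/\mathrm{m}(\Phi_N)\to 0$ for every $g\in G$. A measurable action of $G$ on a probability space $(X,\mathscr B,\mu)$ is a family $(T^g)_{g\in G}$ of measure-preserving transformations with $T^gT^h=T^{gh}$ such that $(g,x)\mapsto T^gx$ is measurable; write $(T^gf)(x)=f(T^gx)$. A sub-$\sigma$-algebra $\mathscr C$ of $\mathscr B$ is $T$ invariant if $(T^g)^{-1}C\in\mathscr C$ for all $C\in\mathscr C$, $g\in G$. Let $\mathscr D$ and $\mathscr E$ be $T$ invariant sub-$\sigma$-algebras of $\mathscr B$, with $\mathscr D\subseteq\mathscr E$ up to $\mu$-null sets. For $f\in L^2(X,\mathscr B,\mu)$ let $\|f\|_x=\mathbb E(|f|^2\mid\mathscr D)(x)^{1/2}$, which for almost every $x$ is the norm of $f$ in $L^2(\mu_x)$ when $(\mu_x)$ is a disintegration of $\mu$ over $\mathscr D$.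 A function $f\in L^2(X,\mathscr E,\mu)$ is called $T$ almost-periodic over $\mathscr D$ if for every $\epsilon>0$ there are a finite set $\Xi\subset L^\infty(X,\mathscr E,\mu)$ and a set $A\in\mathscr D$ with $\mu(A)>1-\epsilon$ such that $\min\{\|T^\gamma f-\xi\|_x:\xi\in\Xi\}\le\epsilon$ for every $\gamma\in\Gamma$ and almost every $x\in A$. The extension $\mathscr E\to\mathscr D$ is called $T$ almost-periodic (or compact) if the functions in $L^2(X,\mathscr E,\mu)$ that are $T$ almost-periodic over $\mathscr D$ are dense in $L^2(X,\mathscr E,\mu)$. **Theorem.** Let $T_1,\dots,T_k$ be commuting ($T_i^gT_j^h=T_j^hT_i^g$ for all $g,h\in G$ and $i\ne j$) measurable actions of $G$ on a probability space $(X,\mathscr B,\mu)$ whose $\sigma$-algebra is countably generated and separates points. Let $\mathscr D$ be a sub-$\sigma$-algebra of $\mathscr B$ that is $T_k\cdots T_i$ invariant for all $1\le i\le k$. Suppose that $$\liminf_{N\to\infty}\frac1{\mathrm{m}(\Phi_N)}\int_{\Phi_N}\int f\prod_{i=1}^kT_k^g\cdots T_i^g\,\mathbb E(f\mid\mathscr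 D)\,d\mu\,d\mathrm{m}(g)>0$$ for every $f>0$ in $L^\infty(X,\mathscr B,\mu)$, where $f>0$ means that $f\ge0$ almost everywhere and $f\ne0$ in $L^\infty$. For each $1\le i\le k$ let $\mathscr E_i$ be a $T_k\cdots T_i$ invariant sub-$\sigma$-algebra of $\mathscr B$, containing $\mathscr D$ up to $\mu$-null sets, such that $\mathscr E_i\to\mathscr D$ is $T_k\cdots T_i$ almost-periodic. Then $$\liminf_{N\to\infty}\frac1{\mathrm{m}(\Phi_N)}\int_{\Phi_N}\int f\prod_{i=1}^kT_k^g\cdots T_i^g\,\mathbb E(f\mid\mathscr E_i)\,d\mu\,d\mathrm{m}(g)>0$$ for every $f>0$ in $L^\infty(X,\mathscr B,\mu)$. -/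

import Mathlib

open MeasureTheory Filter Topology
open scoped ENNReal Pointwise

/-- A left Følner sequence for the left Haar measure `m`: compact sets of positive measure that are
asymptotically invariant under left translations. -/
structure IsLeftFolner {G : Type*} [Group G] [TopologicalSpace G] {mG : MeasurableSpace G}
    (m : Measure G) (Φ : ℕ → Set G) : Prop where
  isCompact : ∀ N, IsCompact (Φ N)
  pos : ∀ N, 0 < m (Φ N)
  tendsto : ∀ g : G, Tendsto (fun N => m (symmDiff (Φ N) (g • Φ N)) / m (Φ N)) atTop (𝓝 0)

/-- A measurable action of `G` on `(X, μ)`: measure-preserving transformations `T g` with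
`T g ∘ T h = T (g * h)` such that `(g, x) ↦ T g x` is jointly measurable. -/
structure IsMeasurableAction {G X : Type*} [Group G] [MeasurableSpace G]
    {mX : MeasurableSpace X} (μ : Measure X) (T : G → X → X) : Prop where
  measurable : Measurable (fun p : G × X => T p.1 p.2)
  measurePreserving : ∀ g, MeasurePreserving (T g) μ μ
  comp : ∀ g h, T g ∘ T h = T (g * h)

/-- The actions `T i` commute pairwise. -/
def ActionsCommute {G X : Type*} {k : ℕ} (T : Fin k → G → X → X) : Prop :=
  ∀ i j, i ≠ j → ∀ g h, T i g ∘ T j h = T j h ∘ T i g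

/-- The family of maps `T_k^g ∘ ⋯ ∘ T_i^g`: for the increasing list `[i, …, k]` of indices, the map
with the smallest index is applied first. -/
def tailAction {G X : Type*} {k : ℕ} (T : Fin k → G → X → X) (i : Fin k) (g : G) : X → X :=
  ((List.finRange k).filter (fun j => i ≤ j)).foldr (fun j S => S ∘ T j g) id

/-- The `σ`-algebra `C` is invariant: `(S g)⁻¹ A ∈ C` for all `A ∈ C` and all `g`. -/
def IsInvariantSigmaAlgebra {G X : Type*} (S : G → X → X) (C : MeasurableSpace X) : Prop :=
  ∀ g, ∀ A : Set X, MeasurableSet[C] A → MeasurableSet[C] (S g ⁻¹' A)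

/-- The fibre norm `x ↦ ‖f‖_x`, where `‖f‖_x² = ∫ f² dμ_x` for the disintegration `μ_x` of `μ`
over `D`; as a function of `x` it is defined almost everywhere, and `∫ f² dμ_x = E(f² | D)(x)`. -/
noncomputable def fibreNorm {X : Type*} (D : MeasurableSpace X) {mX : MeasurableSpace X}
    (μ : Measure X) (f : X → ℝ) : X → ℝ :=
  fun x => √((μ[fun y => f y ^ 2 | D]) x)

/-- `f ∈ L²(X, E, μ)` is almost-periodic for the action `S` and the extension `E → D`, where
`Γ` is the fixed countable dense subgroup: for every `ε > 0` there are a finite set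
`Ξ ⊆ L^∞(X, E, μ)` and a set `A ∈ D` with `μ(A) > 1 - ε` such that
`min {‖S^γ f - ξ‖_x : ξ ∈ Ξ} ≤ ε` for all `γ ∈ Γ` and almost all `x ∈ A`. -/
def IsAlmostPeriodic {G X : Type*} [Group G] (Γ : Subgroup G) (S : G → X → X)
    (E D : MeasurableSpace X) {mX : MeasurableSpace X} (μ : Measure X) (f : Lp ℝ 2 μ) : Prop :=
  f ∈ lpMeas ℝ ℝ E 2 μ ∧
    ∀ ε : ℝ, 0 < ε → ∃ (Ξ : Finset (Lp ℝ ∞ μ)) (A : Set X),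
      (∀ ξ ∈ Ξ, ξ ∈ lpMeas ℝ ℝ E ∞ μ) ∧ MeasurableSet[D] A ∧ 1 - ε < μ.real A ∧
        ∀ γ ∈ Γ, ∀ᵐ x ∂μ, x ∈ A →
          ∃ ξ ∈ Ξ, fibreNorm D μ (fun y => f (S γ y) - ξ y) x ≤ ε

/-- The extension `E → D` is compact for the action `S`: both `σ`-algebras are invariant,
`D` is contained in `E` modulo null sets (that is, `L²(X, D, μ) ⊆ L²(X, E, μ)`), and the closure
in `L²` of the set of almost-periodic functions is all of `L²(X, E, μ)`. -/
structure IsCompactExtension {G X : Type*} [Group G] (Γ : Subgroup G) (S : G → X → X)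
    (E D : MeasurableSpace X) {mX : MeasurableSpace X} (μ : Measure X) : Prop where
  invariant_top : IsInvariantSigmaAlgebra S E
  invariant_base : IsInvariantSigmaAlgebra S D
  le : lpMeas ℝ ℝ D 2 μ ≤ lpMeas ℝ ℝ E 2 μ
  closure_eq : closure {f : Lp ℝ 2 μ | IsAlmostPeriodic Γ S E D μ f} =
    (lpMeas ℝ ℝ E 2 μ : Set (Lp ℝ 2 μ))

/-- The average over `g ∈ Φ` of `∫ f ∏ᵢ T_k^g ⋯ T_i^g hᵢ dμ`, with `(T^g h)(x) = h (T^g x)`. -/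
noncomputable def multipleAverage {G X : Type*} {mG : MeasurableSpace G} {mX : MeasurableSpace X}
    {k : ℕ} (m : Measure G) (μ : Measure X) (T : Fin k → G → X → X) (Φ : Set G)
    (f : X → ℝ) (h : Fin k → X → ℝ) : ℝ :=
  (m.real Φ)⁻¹ * ∫ g in Φ, ∫ x, f x * ∏ i, h i (tailAction T i g x) ∂μ ∂m

/-!
The maps `S i g = T_k^g ∘ ⋯ ∘ T_i^g` form measurable actions again, because the `T i` commute
(`isMeasurableAction_tailAction`); from then on the actions `S i` may be arbitrary. Write `F i` for
`E(f | E i)`, rescaled to take values in `[0, 1]`.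

Compactness of `E i → D` says that, over a set `A ∈ D` of nearly full measure, the translates of
`F i` by elements of `Γ` are totally bounded on the fibres. Measurable actions are strongly
continuous, so this extends to translates by all of `G`. As `F i` is only a limit of
almost-periodic functions, it is asserted for those `g` which return the point to `A`
(`IsCompactExtension.exists_cover`).

Since `∫ f ∏ F i > 0`, the set `A` can be taken inside a set where `E(f ∏ F i | D)` exceeds a
constant `c > 0`. Among the finite families `t` in `G` for which the vectors `(F i ∘ S i (t j))ᵢ`
are `ε`-separated on the fibres over a subset of `A` of positive measure, there is one of maximal
size. If `x` and all the `S i g x` lie in the corresponding set `A' ∈ D`, then the family `t j * g`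
is still separated on the fibre of `x`, so by maximality some `t j * g` nearly fixes all the `F i`
there (`exists_returning_set`). Taking `ε` small in terms of `c`, this yields
`(c / 2) μ(A' ∩ ⋂ᵢ (S i g)⁻¹ A') ≤ ∑ⱼ φ(t j * g)` with `φ g = ∫ f ∏ F i ∘ S i g`
(`exists_mul_measureReal_le_sum_corr`).

The left side has positive lower average by the hypothesis on `D`, applied to the indicator function
of `A'`; on the right the left translations by `t j` do not change averages along a left Følner
sequence. Hence `φ` has positive lower average (`exists_eventually_le_average_corr`).

The fibre norms are handled through conditional second moments, without a disintegration of `μ`.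
-/

/-! ### The composed actions -/

theorem comp_foldr_comm {G X : Type*} {k : ℕ} {T : Fin k → G → X → X} (hcomm : ActionsCommute T)
    (j : Fin k) (g h : G) (l : List (Fin k)) (hj : j ∉ l) :
    T j g ∘ l.foldr (fun i S => S ∘ T i h) id = l.foldr (fun i S => S ∘ T i h) id ∘ T j g := by
  induction l with
  | nil => rfl
  | cons a l ih =>
    have ha : j ≠ a := fun e => hj (e ▸ List.mem_cons_self)
    have hl := ih fun e => hj (List.mem_cons_of_mem _ e)
    simp only [List.foldr_cons]
    rw [← Function.comp_assoc, hl, Function.comp_assoc, hcomm j a ha g h, Function.comp_assoc]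

section Composed

variable {G X : Type*} [Group G] [MeasurableSpace G] {mX : MeasurableSpace X} {μ : Measure X}

theorem isMeasurableAction_foldr {k : ℕ} {T : Fin k → G → X → X}
    (hT : ∀ i, IsMeasurableAction μ (T i)) (hcomm : ActionsCommute T)
    (l : List (Fin k)) (hl : l.Nodup) :
    IsMeasurableAction μ (fun g => l.foldr (fun j S => S ∘ T j g) id) := by
  induction l with
  | nil => exact ⟨measurable_snd, fun g => MeasurePreserving.id μ, fun g h => rfl⟩
  | cons a l ih =>
    obtain ⟨ha, hl⟩ := List.nodup_cons.1 hl
    have ih := ih hl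
    refine ⟨?_, fun g => ?_, fun g h => ?_⟩
    · exact ih.measurable.comp (measurable_fst.prodMk (hT a).measurable)
    · exact (ih.measurePreserving g).comp ((hT a).measurePreserving g)
    · have hc := comp_foldr_comm hcomm a g h l ha
      have h1 := ih.comp g h
      simp only [List.foldr_cons] at h1 ⊢
      rw [← (hT a).comp g h, ← h1]
      simp only [Function.comp_assoc]
      rw [← Function.comp_assoc (T a g), hc, Function.comp_assoc]

/-- Since the actions commute, the maps `T_k^g ∘ ⋯ ∘ T_i^g` form an action again. -/
theorem isMeasurableAction_tailAction {k : ℕ} {T : Fin k → G → X → X}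
    (hT : ∀ i, IsMeasurableAction μ (T i)) (hcomm : ActionsCommute T) (i : Fin k) :
    IsMeasurableAction μ (tailAction T i) :=
  isMeasurableAction_foldr hT hcomm _ ((List.nodup_finRange k).filter _)

end Composed

/-! ### Conditional expectations and measurable actions -/

namespace IsMeasurableAction

variable {G X : Type*} [Group G] [MeasurableSpace G]

/-- The identity of `G` need not act as the identity map, but it acts trivially modulo null sets:
`S 1` is idempotent, so the set where `h ∘ S 1` and `h` differ has empty preimage under `S 1`. -/
theorem comp_one_ae {mX : MeasurableSpace X} {μ : Measure X} {S : G → X → X}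
    (hS : IsMeasurableAction μ S) {h : X → ℝ} (hh : Measurable h) :
    (fun x => h (S 1 x)) =ᵐ[μ] h := by
  have hm := (hS.measurePreserving 1).measurable
  have hZ : MeasurableSet {x | ¬ h (S 1 x) = h x} :=
    (measurableSet_eq_fun (hh.comp hm) hh).compl
  have hSS : ∀ x, S 1 (S 1 x) = S 1 x := fun x => by
    have := congrFun (hS.comp 1 1) x
    rwa [mul_one] at this
  have hpre := (hS.measurePreserving 1).measure_preimage hZ.nullMeasurableSet
  have he : S 1 ⁻¹' {x | ¬ h (S 1 x) = h x} = ∅ := by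
    ext x
    simp [hSS]
  rw [he, measure_empty] at hpre
  exact hpre.symm

theorem mem_one_ae {mX : MeasurableSpace X} {μ : Measure X} {S : G → X → X}
    (hS : IsMeasurableAction μ S) {A : Set X} (hA : MeasurableSet A) :
    ∀ᵐ x ∂μ, S 1 x ∈ A ↔ x ∈ A := by
  filter_upwards [hS.comp_one_ae ((measurable_const (a := (1 : ℝ))).indicator hA)] with x hx
  by_cases h1 : S 1 x ∈ A <;> by_cases h2 : x ∈ A <;> simp_all [Set.indicator]

/-- Conditional expectations onto an invariant `σ`-algebra commute with the action. The inclusion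
`(S g)⁻¹ D ⊆ D` alone would not suffice; invariance under `S g⁻¹` gives the reverse one. -/
theorem condExp_comp {D mX : MeasurableSpace X} {μ : Measure X} [IsProbabilityMeasure μ]
    {S : G → X → X} (hS : IsMeasurableAction μ S) (hD : D ≤ mX)
    (hinv : IsInvariantSigmaAlgebra S D) {h : X → ℝ} (hh : Integrable h μ) (g : G) :
    μ[fun x => h (S g x) | D] =ᵐ[μ] fun x => (μ[h | D]) (S g x) := by
  have hmp := hS.measurePreserving g
  have hi : Integrable (fun x => h (S g x)) μ := hmp.integrable_comp_of_integrable hh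
  have hi' : Integrable (fun x => (μ[h | D]) (S g x)) μ :=
    hmp.integrable_comp_of_integrable integrable_condExp
  symm
  refine ae_eq_condExp_of_forall_setIntegral_eq hD hi (fun s _ _ => hi'.integrableOn) ?_ ?_
  · intro A hA _
    set A' := S g⁻¹ ⁻¹' A with hA'
    have hA'D : MeasurableSet[D] A' := hinv _ _ hA
    have key : ∀ u : X → ℝ, Integrable u μ →
        ∫ x in A, u (S g x) ∂μ = ∫ x in A', u x ∂μ := by
      intro u hu
      rw [← integral_indicator (hD _ hA), ← integral_indicator (hD _ hA'D)]
      have h1 : ∫ x, A'.indicator u x ∂μ = ∫ x, A'.indicator u (S g x) ∂μ := by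
        rw [← integral_map hmp.measurable.aemeasurable, hmp.map_eq]
        rw [hmp.map_eq]
        exact hu.aestronglyMeasurable.indicator (hD _ hA'D)
      rw [h1]
      refine integral_congr_ae ?_
      filter_upwards [hS.mem_one_ae (hD _ hA)] with x hx
      have hxx : S g x ∈ A' ↔ x ∈ A := by
        rw [← hx, hA', Set.mem_preimage]
        have := congrFun (hS.comp g⁻¹ g) x
        rw [inv_mul_cancel] at this
        rw [← this]; rfl
      by_cases hxA : x ∈ A
      · rw [Set.indicator_of_mem hxA, Set.indicator_of_mem (hxx.2 hxA)]
      · rw [Set.indicator_of_notMem hxA, Set.indicator_of_notMem (fun e => hxA (hxx.1 e))]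
    rw [key _ hh, key _ integrable_condExp, setIntegral_condExp hD hh hA'D]
  · have hm : Measurable[D, D] (S g) := fun A hA => hinv g A hA
    have : StronglyMeasurable[D] (fun x => (μ[h | D]) (S g x)) :=
      (stronglyMeasurable_condExp (m := D)).comp_measurable hm
    exact this.aestronglyMeasurable

end IsMeasurableAction

/-! ### Strong continuity -/

theorem integral_sq_sub_toLp {X : Type*} {mX : MeasurableSpace X} {μ : Measure X}
    {u : X → ℝ} (hu : MemLp u 2 μ) (v : Lp ℝ 2 μ) :
    ‖hu.toLp u - v‖ ^ 2 = ∫ x, (u x - v x) ^ 2 ∂μ := by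
  rw [← real_inner_self_eq_norm_sq, L2.inner_def]
  refine integral_congr_ae ?_
  filter_upwards [Lp.coeFn_sub (hu.toLp u) v, hu.coeFn_toLp] with x h1 h2
  simp only [h1, Pi.sub_apply, h2, real_inner_self_eq_norm_sq, Real.norm_eq_abs, sq_abs]

namespace IsMeasurableAction

variable {G X : Type*} [Group G] [TopologicalSpace G] [IsTopologicalGroup G]
  [LocallyCompactSpace G] [SecondCountableTopology G] [MeasurableSpace G] [BorelSpace G]

/-- A measurable action is strongly continuous on `L²`: by separability the elements `g` that move
`h` into a suitable small ball form a set of positive Haar measure, and by Steinhaus' theorem the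
quotients of two of them fill a neighbourhood of the identity. -/
theorem eventually_integral_sq_lt [T2Space G] (m : Measure G) [m.IsHaarMeasure]
    {mX : MeasurableSpace X} [MeasurableSpace.CountablyGenerated X] {μ : Measure X}
    [IsProbabilityMeasure μ] {S : G → X → X} (hS : IsMeasurableAction μ S)
    {h : X → ℝ} (hh : Measurable h) (h2 : MemLp h 2 μ) {δ : ℝ} (hδ : 0 < δ) :
    ∀ᶠ u in 𝓝 (1 : G), ∫ x, (h (S u x) - h x) ^ 2 ∂μ < δ := by
  have hV : ∀ g, MemLp (fun x => h (S g x)) 2 μ :=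
    fun g => h2.comp_measurePreserving (hS.measurePreserving g)
  have : Fact ((2 : ℝ≥0∞) ≠ ∞) := ⟨ENNReal.ofNat_ne_top⟩
  have : SecondCountableTopology (Lp ℝ 2 μ) := inferInstance
  obtain ⟨v, hv⟩ := TopologicalSpace.exists_dense_seq (Lp ℝ 2 μ)
  let E : ℕ → Set G := fun n => {g | ∫ x, (h (S g x) - v n x) ^ 2 ∂μ < δ / 4}
  have hE : ∀ n, MeasurableSet (E n) := by
    intro n
    have hvm : Measurable (v n : X → ℝ) := (Lp.stronglyMeasurable (v n)).measurable
    have h1 : Measurable fun p : G × X => (h (S p.1 p.2) - v n p.2) ^ 2 :=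
      ((hh.comp hS.measurable).sub (hvm.comp measurable_snd)).pow_const 2
    have h2 : StronglyMeasurable fun g => ∫ x, (h (S g x) - v n x) ^ 2 ∂μ :=
      h1.stronglyMeasurable.integral_prod_right
    exact measurableSet_lt h2.measurable measurable_const
  have hU : ⋃ n, E n = Set.univ := by
    refine Set.eq_univ_of_forall fun g => ?_
    obtain ⟨n, hn⟩ := hv.exists_dist_lt ((hV g).toLp _) (ε := √(δ / 4)) (by positivity)
    refine Set.mem_iUnion.2 ⟨n, ?_⟩
    change ∫ x, (h (S g x) - v n x) ^ 2 ∂μ < δ / 4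
    rw [← integral_sq_sub_toLp (hV g), ← dist_eq_norm]
    exact (Real.lt_sqrt dist_nonneg).1 hn
  obtain ⟨n, hn⟩ : ∃ n, 0 < m (E n) := by
    by_contra! hcon
    have : m (⋃ n, E n) = 0 := measure_iUnion_null fun n => le_antisymm (hcon n) bot_le
    rw [hU] at this
    exact (isOpen_univ.measure_pos m Set.univ_nonempty).ne' this
  filter_upwards [Measure.div_mem_nhds_one_of_haar_pos m (E n) (hE n) hn] with u hu
  obtain ⟨a, ha, b, hb, rfl⟩ := Set.mem_div.1 hu
  have hmp := hS.measurePreserving b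
  have hmeas : Measurable fun x => (h (S (a / b) x) - h x) ^ 2 :=
    ((hh.comp (hS.measurePreserving _).measurable).sub hh).pow_const 2
  have hab : ∀ x, S (a / b) (S b x) = S a x := fun x => by
    have := congrFun (hS.comp (a / b) b) x
    rwa [div_mul_cancel] at this
  have h1 : ∫ x, (h (S (a / b) x) - h x) ^ 2 ∂μ = ∫ x, (h (S a x) - h (S b x)) ^ 2 ∂μ := by
    have := integral_map (μ := μ) hmp.measurable.aemeasurable
      (f := fun x => (h (S (a / b) x) - h x) ^ 2) hmeas.aestronglyMeasurable
    rw [hmp.map_eq] at this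
    rw [this]
    simp only [hab]
  have hint : ∀ g, Integrable (fun x => (h (S g x) - v n x) ^ 2) μ := fun g =>
    ((hV g).sub (Lp.memLp (v n))).integrable_sq
  have h3 : ∫ x, (h (S a x) - h (S b x)) ^ 2 ∂μ ≤
      ∫ x, (2 * (h (S a x) - v n x) ^ 2 + 2 * (h (S b x) - v n x) ^ 2) ∂μ := by
    refine integral_mono ((hV a).sub (hV b)).integrable_sq
      (((hint a).const_mul 2).add ((hint b).const_mul 2)) fun x => ?_
    change (h (S a x) - h (S b x)) ^ 2 ≤ _
    nlinarith [sq_nonneg ((h (S a x) - v n x) + (h (S b x) - v n x))]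
  rw [integral_add ((hint a).const_mul 2) ((hint b).const_mul 2), integral_const_mul,
    integral_const_mul] at h3
  have ha' : ∫ x, (h (S a x) - v n x) ^ 2 ∂μ < δ / 4 := ha
  have hb' : ∫ x, (h (S b x) - v n x) ^ 2 ∂μ < δ / 4 := hb
  rw [h1]
  linarith

/-- Every element of `G` is approximated by elements of a dense set, uniformly on `h`. -/
theorem exists_mem_integral_sq_lt [T2Space G] (m : Measure G) [m.IsHaarMeasure]
    {mX : MeasurableSpace X} [MeasurableSpace.CountablyGenerated X] {μ : Measure X}
    [IsProbabilityMeasure μ] {S : G → X → X} (hS : IsMeasurableAction μ S)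
    {h : X → ℝ} (hh : Measurable h) (h2 : MemLp h 2 μ) {Γ : Set G} (hΓ : Dense Γ) (g : G)
    {δ : ℝ} (hδ : 0 < δ) :
    ∃ γ ∈ Γ, ∫ x, (h (S γ x) - h (S g x)) ^ 2 ∂μ < δ := by
  have hev := hS.eventually_integral_sq_lt m hh h2 hδ
  have ht : Tendsto (fun γ : G => γ * g⁻¹) (𝓝 g) (𝓝 1) := by
    have : Continuous fun γ : G => γ * g⁻¹ := continuous_mul_const _
    simpa using this.tendsto g
  obtain ⟨γ, hγ, hγΓ⟩ := mem_closure_iff_nhds.1 (hΓ g) _ (ht.eventually hev)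
  refine ⟨γ, hγΓ, ?_⟩
  have hγ : ∫ x, (h (S (γ * g⁻¹) x) - h x) ^ 2 ∂μ < δ := hγ
  have hmp := hS.measurePreserving g
  have hmeas : Measurable fun x => (h (S (γ * g⁻¹) x) - h x) ^ 2 :=
    ((hh.comp (hS.measurePreserving _).measurable).sub hh).pow_const 2
  have := integral_map (μ := μ) hmp.measurable.aemeasurable
    (f := fun x => (h (S (γ * g⁻¹) x) - h x) ^ 2) hmeas.aestronglyMeasurable
  rw [hmp.map_eq] at this
  rw [this] at hγ
  have hab : ∀ x, S (γ * g⁻¹) (S g x) = S γ x := fun x => by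
    have := congrFun (hS.comp (γ * g⁻¹) g) x
    rwa [inv_mul_cancel_right] at this
  simpa only [hab] using hγ

end IsMeasurableAction

/-! ### Conditional second moments -/

/-- The conditional second moment `E(u² | D)`, the square of the fibre norm of `u`. -/
noncomputable def condSq {X : Type*} (D : MeasurableSpace X) {mX : MeasurableSpace X}
    (μ : Measure X) (u : X → ℝ) : X → ℝ :=
  μ[fun y => u y ^ 2 | D]

section CondSq

variable {X : Type*} {D mX : MeasurableSpace X} {μ : Measure X}

theorem measurable_condSq (u : X → ℝ) : Measurable[D] (condSq D μ u) :=
  (stronglyMeasurable_condExp (m := D)).measurable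

theorem condSq_congr {u v : X → ℝ} (h : u =ᵐ[μ] v) : condSq D μ u =ᵐ[μ] condSq D μ v :=
  condExp_congr_ae (h.mono fun x hx => by simp only [hx])

theorem condSq_sub_comm (u v : X → ℝ) :
    condSq D μ (fun x => u x - v x) = condSq D μ (fun x => v x - u x) := by
  unfold condSq
  congr 1
  ext x
  ring

/-- A weak triangle inequality, sufficient in place of Minkowski's inequality on the fibres. -/
theorem condSq_triangle {a b c : X → ℝ} (hab : MemLp (fun x => a x - b x) 2 μ)
    (hbc : MemLp (fun x => b x - c x) 2 μ) :
    ∀ᵐ x ∂μ, condSq D μ (fun x => a x - c x) x ≤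
      2 * condSq D μ (fun x => a x - b x) x + 2 * condSq D μ (fun x => b x - c x) x := by
  have h1 := hab.integrable_sq
  have h2 := hbc.integrable_sq
  have hac : MemLp (fun x => a x - c x) 2 μ := by
    refine (hab.add hbc).ae_eq (ae_of_all _ fun x => ?_)
    simp
  have h3 := hac.integrable_sq
  have hle := condExp_mono (m := D) h3 ((h1.smul (2 : ℝ)).add (h2.smul (2 : ℝ)))
    (ae_of_all _ fun x => by
      simp only [Pi.add_apply, Pi.smul_apply, smul_eq_mul]
      nlinarith [sq_nonneg ((a x - b x) - (b x - c x))])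
  filter_upwards [hle, condExp_add (h1.smul (2 : ℝ)) (h2.smul (2 : ℝ)) D,
    condExp_smul (μ := μ) (2 : ℝ) (fun x => (a x - b x) ^ 2) D,
    condExp_smul (μ := μ) (2 : ℝ) (fun x => (b x - c x) ^ 2) D] with x e1 e2 e3 e4
  rw [e2, Pi.add_apply, e3, e4] at e1
  simpa [condSq] using e1

theorem mul_measureReal_condSq_le [IsProbabilityMeasure μ] (hD : D ≤ mX) (u : X → ℝ) (e : ℝ)
    (he : 0 ≤ e) :
    e * μ.real {x | e < condSq D μ u x} ≤ ∫ x, u x ^ 2 ∂μ := by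
  have h0 : 0 ≤ᵐ[μ] condSq D μ u := condExp_nonneg (ae_of_all _ fun x => sq_nonneg _)
  have h1 := mul_meas_ge_le_integral_of_nonneg h0 integrable_condExp e
  have h2 : ∫ x, condSq D μ u x ∂μ = ∫ x, u x ^ 2 ∂μ := integral_condExp hD
  rw [h2] at h1
  refine le_trans (mul_le_mul_of_nonneg_left ?_ he) h1
  exact measureReal_mono fun x hx => (le_of_lt hx : e ≤ condSq D μ u x)

theorem IsMeasurableAction.condSq_comp {G : Type*} [Group G] [MeasurableSpace G]
    [IsProbabilityMeasure μ] {S : G → X → X} (hS : IsMeasurableAction μ S) (hD : D ≤ mX)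
    (hinv : IsInvariantSigmaAlgebra S D) {u : X → ℝ} (hu : MemLp u 2 μ) (g : G) :
    condSq D μ (fun x => u (S g x)) =ᵐ[μ] fun x => condSq D μ u (S g x) :=
  hS.condExp_comp hD hinv hu.integrable_sq g

end CondSq

/-! ### Fibrewise total boundedness -/

section Cover

variable {G X : Type*} [Group G] [TopologicalSpace G] [IsTopologicalGroup G]
  [LocallyCompactSpace G] [SecondCountableTopology G] [T2Space G] [MeasurableSpace G]
  [BorelSpace G]

/-- A fibrewise covering of the translates of `F` by elements of a dense set covers, up to a
factor, the translates by all elements of `G`: by strong continuity the exceptional set has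
arbitrarily small measure. -/
theorem ae_exists_condSq_le_of_dense (m : Measure G) [m.IsHaarMeasure]
    {Γ : Set G} (hΓ : Dense Γ) {D mX : MeasurableSpace X} [MeasurableSpace.CountablyGenerated X]
    {μ : Measure X} [IsProbabilityMeasure μ] {S : G → X → X} (hS : IsMeasurableAction μ S)
    (hD : D ≤ mX) {F : X → ℝ} (hF : Measurable F) (hF2 : MemLp F 2 μ)
    {Ξ : Finset (Lp ℝ ∞ μ)} {A : Set X} {e : ℝ} (he : 0 < e)
    (hA : ∀ γ ∈ Γ, ∀ᵐ x ∂μ, x ∈ A → ∃ ξ ∈ Ξ, condSq D μ (fun y => F (S γ y) - ξ y) x ≤ e)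
    (g : G) :
    ∀ᵐ x ∂μ, x ∈ A → ∃ ξ ∈ Ξ, condSq D μ (fun y => F (S g y) - ξ y) x ≤ 4 * e := by
  set Z : Set X := {x | ¬ (x ∈ A → ∃ ξ ∈ Ξ, condSq D μ (fun y => F (S g y) - ξ y) x ≤ 4 * e)}
    with hZ
  change μ Z = 0
  rw [← measureReal_eq_zero_iff]
  by_contra hne
  have hpos : 0 < μ.real Z := lt_of_le_of_ne measureReal_nonneg (Ne.symm hne)
  obtain ⟨γ, hγ, hlt⟩ := hS.exists_mem_integral_sq_lt m hF hF2 hΓ g (mul_pos he hpos)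
  have hFg : ∀ g, MemLp (fun x => F (S g x)) 2 μ :=
    fun g => hF2.comp_measurePreserving (hS.measurePreserving g)
  have hξ : ∀ ξ : Lp ℝ ∞ μ, MemLp ξ 2 μ := fun ξ => (Lp.memLp ξ).mono_exponent le_top
  have htri : ∀ᵐ x ∂μ, ∀ ξ ∈ Ξ, condSq D μ (fun y => F (S g y) - ξ y) x ≤
      2 * condSq D μ (fun y => F (S g y) - F (S γ y)) x +
      2 * condSq D μ (fun y => F (S γ y) - ξ y) x := by
    refine (Finset.eventually_all Ξ).2 fun ξ _ => ?_
    exact condSq_triangle ((hFg g).sub (hFg γ)) ((hFg γ).sub (hξ ξ))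
  have hsub : Z ≤ᵐ[μ] {x | e < condSq D μ (fun y => F (S γ y) - F (S g y)) x} := by
    filter_upwards [htri, hA γ hγ] with x h1 h2 hx
    have hx' : ¬ (x ∈ A → ∃ ξ ∈ Ξ, condSq D μ (fun y => F (S g y) - ξ y) x ≤ 4 * e) := hx
    push Not at hx'
    obtain ⟨hxA, hx'⟩ := hx'
    obtain ⟨ξ, hξΞ, hle⟩ := h2 hxA
    have h3 := h1 ξ hξΞ
    have h4 := hx' ξ hξΞ
    rw [condSq_sub_comm (fun y => F (S g y)) (fun y => F (S γ y))] at h3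
    change e < condSq D μ (fun y => F (S γ y) - F (S g y)) x
    linarith
  have h5 := mul_measureReal_condSq_le (μ := μ) hD (fun y => F (S γ y) - F (S g y)) e he.le
  have h6 : μ.real Z ≤ μ.real {x | e < condSq D μ (fun y => F (S γ y) - F (S g y)) x} :=
    ENNReal.toReal_mono (measure_ne_top _ _) (measure_mono_ae hsub)
  have h7 := mul_le_mul_of_nonneg_left h6 he.le
  linarith [h5.trans_lt hlt]

/-- For a compact extension `E → D`, every `F ∈ L²(E)` has, over a set `A ∈ D` of almost full
measure, fibrewise totally bounded orbits, if only the translates by those `g` that return `x`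
to `A` are considered. -/
theorem IsCompactExtension.exists_cover (m : Measure G) [m.IsHaarMeasure]
    {Γ : Subgroup G} (hΓ : Dense (Γ : Set G)) {E D mX : MeasurableSpace X}
    [MeasurableSpace.CountablyGenerated X]
    {μ : Measure X} [IsProbabilityMeasure μ] {S : G → X → X} (hS : IsMeasurableAction μ S)
    (hD : D ≤ mX) (hc : IsCompactExtension Γ S E D μ) {F : X → ℝ} (hF2 : MemLp F 2 μ)
    (hFE : StronglyMeasurable[E] F) {e η : ℝ} (he : 0 < e) (hη : 0 < η) :
    ∃ (Ξ : Finset (Lp ℝ ∞ μ)) (A : Set X), MeasurableSet[D] A ∧ 1 - η < μ.real A ∧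
      ∀ g, ∀ᵐ x ∂μ, x ∈ A → S g x ∈ A →
        ∃ ξ ∈ Ξ, condSq D μ (fun y => F (S g y) - ξ y) x ≤ e := by
  have hmem : hF2.toLp F ∈ closure {f : Lp ℝ 2 μ | IsAlmostPeriodic Γ S E D μ f} := by
    rw [hc.closure_eq]
    exact mem_lpMeas_iff_aestronglyMeasurable.2
      (hFE.aestronglyMeasurable.congr hF2.coeFn_toLp.symm)
  -- the weak triangle inequality will give `2 * (e / 4) + 2 * (4 * (e / 16)) = e`; by Markov's
  -- inequality `E((F - H)² | D) ≤ e / 4` off a set of measure less than `η / 2`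
  obtain ⟨H, hH, hdist⟩ := Metric.mem_closure_iff.1 hmem (√(e / 4 * (η / 2))) (by positivity)
  have hclose : ∫ x, (F x - H x) ^ 2 ∂μ < e / 4 * (η / 2) := by
    rw [← integral_sq_sub_toLp hF2, ← dist_eq_norm]
    exact (Real.lt_sqrt dist_nonneg).1 hdist
  have hHm : Measurable H := (Lp.stronglyMeasurable H).measurable
  have hH2 : MemLp H 2 μ := Lp.memLp H
  obtain ⟨Ξ, A, -, hAD, hAμ, hAΓ⟩ := hH.2 (min (η / 2) (√(e / 16)))
    (lt_min (by positivity) (by positivity))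
  have hcov := ae_exists_condSq_le_of_dense m hΓ hS hD hHm hH2 (Ξ := Ξ) (A := A) (e := e / 16)
    (by positivity) (fun γ hγ => by
      filter_upwards [hAΓ γ hγ] with x hx hxA
      obtain ⟨ξ, hξ, hle⟩ := hx hxA
      exact ⟨ξ, hξ, (Real.sqrt_le_sqrt_iff (by positivity)).1 (hle.trans (min_le_right _ _))⟩)
  set B : Set X := {x | e / 4 < condSq D μ (fun x => F x - H x) x} with hB
  have hBD : MeasurableSet[D] B :=
    measurable_condSq (D := D) (μ := μ) (fun x => F x - H x) measurableSet_Ioi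
  have hBμ : μ.real B < η / 2 := by
    have h1 := mul_measureReal_condSq_le (μ := μ) hD (fun x => F x - H x) (e / 4) (by positivity)
    have h2 := h1.trans_lt hclose
    exact lt_of_mul_lt_mul_left h2 (by positivity)
  refine ⟨Ξ, A \ B, @MeasurableSet.diff _ D _ _ hAD hBD, ?_, fun g => ?_⟩
  · have h1 := measureReal_sdiff_add_inter (μ := μ) (s := A) (hD _ hBD)
    have h2 : μ.real (A ∩ B) ≤ μ.real B := measureReal_mono Set.inter_subset_right
    have h3 := min_le_left (η / 2) (√(e / 16))
    linarith
  · have hFg : MemLp (fun x => F (S g x)) 2 μ :=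
      hF2.comp_measurePreserving (hS.measurePreserving g)
    have hHg : MemLp (fun x => H (S g x)) 2 μ :=
      hH2.comp_measurePreserving (hS.measurePreserving g)
    have hξ : ∀ ξ : Lp ℝ ∞ μ, MemLp ξ 2 μ := fun ξ => (Lp.memLp ξ).mono_exponent le_top
    have htri : ∀ᵐ x ∂μ, ∀ ξ ∈ Ξ, condSq D μ (fun y => F (S g y) - ξ y) x ≤
        2 * condSq D μ (fun y => F (S g y) - H (S g y)) x +
        2 * condSq D μ (fun y => H (S g y) - ξ y) x := by
      refine (Finset.eventually_all Ξ).2 fun ξ _ => ?_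
      exact condSq_triangle (hFg.sub hHg) (hHg.sub (hξ ξ))
    have hcomp : condSq D μ (fun y => F (S g y) - H (S g y)) =ᵐ[μ]
        fun x => condSq D μ (fun x => F x - H x) (S g x) :=
      hS.condSq_comp hD hc.invariant_base (hF2.sub hH2) g
    filter_upwards [htri, hcov g, hcomp] with x h1 h2 h3 hx hgx
    obtain ⟨ξ, hξΞ, hle⟩ := h2 hx.1
    refine ⟨ξ, hξΞ, (h1 ξ hξΞ).trans ?_⟩
    have h4 : ¬ e / 4 < condSq D μ (fun x => F x - H x) (S g x) := hgx.2
    rw [h3]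
    linarith

end Cover

/-! ### Maximal fibrewise separated families -/

section Separated

variable {ι G X : Type*}

/-- The set of `x ∈ A` over which the vectors `(F i ∘ S i (t j))ᵢ`, for `j < M`, are pairwise
separated in the fibre norm and all the points `S i (t j) x` lie in `A`. The pattern `p` prescribes
the coordinate `p j l` in which the vectors with indices `j < l` are separated; fixing it makes the
condition stable under moving `x` by different actions `S i g`. -/
def sepSet (D : MeasurableSpace X) {mX : MeasurableSpace X} (μ : Measure X) (S : ι → G → X → X)
    (F : ι → X → ℝ) (A : Set X) (e : ℝ) {M : ℕ} (t : Fin M → G) (p : Fin M → Fin M → ι) : Set X :=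
  {x | x ∈ A ∧ (∀ i j, S i (t j) x ∈ A) ∧ ∀ j l, j < l →
    4 * e < condSq D μ (fun y => F (p j l) (S (p j l) (t j) y) - F (p j l) (S (p j l) (t l) y)) x}

variable {D mX : MeasurableSpace X} {μ : Measure X} {S : ι → G → X → X} {F : ι → X → ℝ}
  {A : Set X} {e : ℝ}

theorem measurableSet_sepSet [Countable ι] (hinv : ∀ i, IsInvariantSigmaAlgebra (S i) D)
    (hA : MeasurableSet[D] A) {M : ℕ} (t : Fin M → G) (p : Fin M → Fin M → ι) :
    MeasurableSet[D] (sepSet D μ S F A e t p) := by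
  have h1 : MeasurableSet[D] {x | ∀ i j, S i (t j) x ∈ A} := by
    simp only [Set.ofPred_forall]
    exact @MeasurableSet.iInter _ _ D _ _ fun i => @MeasurableSet.iInter _ _ D _ _ fun j =>
      hinv i (t j) A hA
  have h2 : MeasurableSet[D] {x | ∀ j l, j < l → 4 * e <
      condSq D μ (fun y => F (p j l) (S (p j l) (t j) y) - F (p j l) (S (p j l) (t l) y)) x} := by
    simp only [Set.ofPred_forall]
    exact @MeasurableSet.iInter _ _ D _ _ fun j => @MeasurableSet.iInter _ _ D _ _ fun l =>
      @MeasurableSet.iInter _ _ D _ _ fun _ => measurable_condSq (D := D) (μ := μ)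
        (fun y => F (p j l) (S (p j l) (t j) y) - F (p j l) (S (p j l) (t l) y)) measurableSet_Ioi
  exact @MeasurableSet.inter _ D _ _ hA (@MeasurableSet.inter _ D _ _ h1 h2)

variable [Fintype ι] [Group G] [MeasurableSpace G]

/-- Pigeonhole: separated families are no larger than the number of vectors `(ξᵢ)ᵢ` with `ξᵢ` in the
finite set covering the orbit of `F i`. -/
theorem card_le_of_sepSet_pos [IsProbabilityMeasure μ] (hS : ∀ i, IsMeasurableAction μ (S i))
    (hF2 : ∀ i, MemLp (F i) 2 μ) (Ξ : ι → Finset (Lp ℝ ∞ μ))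
    (hΞ : ∀ i g, ∀ᵐ x ∂μ, x ∈ A → S i g x ∈ A →
      ∃ ξ ∈ Ξ i, condSq D μ (fun y => F i (S i g y) - ξ y) x ≤ e)
    {M : ℕ} (t : Fin M → G) (p : Fin M → Fin M → ι) (hpos : 0 < μ (sepSet D μ S F A e t p)) :
    M ≤ ∏ i, (Ξ i).card := by
  classical
  rw [← Fintype.card_piFinset]
  by_contra! hlt
  refine hpos.ne' ?_
  have hFg : ∀ i g, MemLp (fun x => F i (S i g x)) 2 μ :=
    fun i g => (hF2 i).comp_measurePreserving ((hS i).measurePreserving g)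
  have hξ : ∀ ξ : Lp ℝ ∞ μ, MemLp ξ 2 μ := fun ξ => (Lp.memLp ξ).mono_exponent le_top
  have htri : ∀ᵐ x ∂μ, ∀ i j l, ∀ ξ ∈ Ξ i,
      condSq D μ (fun y => F i (S i (t j) y) - F i (S i (t l) y)) x ≤
      2 * condSq D μ (fun y => F i (S i (t j) y) - ξ y) x +
      2 * condSq D μ (fun y => ξ y - F i (S i (t l) y)) x := by
    refine ae_all_iff.2 fun i => ae_all_iff.2 fun j => ae_all_iff.2 fun l =>
      (Finset.eventually_all (Ξ i)).2 fun ξ _ => ?_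
    exact condSq_triangle ((hFg i _).sub (hξ ξ)) ((hξ ξ).sub (hFg i _))
  have hcov : ∀ᵐ x ∂μ, ∀ i j, x ∈ A → S i (t j) x ∈ A →
      ∃ ξ ∈ Ξ i, condSq D μ (fun y => F i (S i (t j) y) - ξ y) x ≤ e :=
    ae_all_iff.2 fun i => ae_all_iff.2 fun j => hΞ i (t j)
  have hae : ∀ᵐ x ∂μ, x ∉ sepSet D μ S F A e t p := by
    filter_upwards [htri, hcov] with x h1 h2 hx
    obtain ⟨hxA, hxt, hsep⟩ := hx
    choose ξ hξΞ hξe using fun i j => h2 i j hxA (hxt i j)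
    obtain ⟨a, -, b, -, hab, heq⟩ := Finset.exists_ne_map_eq_of_card_lt_of_maps_to
      (s := (Finset.univ : Finset (Fin M))) (t := Fintype.piFinset Ξ)
      (by simpa using hlt) (f := fun j i => ξ i j)
      (fun j _ => by simpa using fun i => hξΞ i j)
    obtain ⟨j, l, hjl, heq⟩ : ∃ j l, j < l ∧ ∀ i, ξ i j = ξ i l := by
      rcases lt_or_gt_of_ne hab with h | h
      · exact ⟨a, b, h, fun i => congrFun heq i⟩
      · exact ⟨b, a, h, fun i => (congrFun heq i).symm⟩
    have h3 := hsep j l hjl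
    have h4 := h1 (p j l) j l (ξ (p j l) j) (hξΞ _ _)
    have h5 := hξe (p j l) j
    have h6 := hξe (p j l) l
    rw [← heq, condSq_sub_comm] at h6
    linarith
  simpa [ae_iff] using hae

/-- Translating a separated family by `g` and adjoining the identity enlarges it, unless at almost
every point that each `S i g` returns to the separated set some translate is close to `F`. -/
theorem ae_exists_condSq_le_of_maximal [Nonempty ι] [IsProbabilityMeasure μ]
    (hS : ∀ i, IsMeasurableAction μ (S i)) (hD : D ≤ mX)
    (hinv : ∀ i, IsInvariantSigmaAlgebra (S i) D) (hF : ∀ i, Measurable (F i))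
    (hF2 : ∀ i, MemLp (F i) 2 μ) (hA : MeasurableSet[D] A)
    {M : ℕ} (t : Fin M → G) (p : Fin M → Fin M → ι)
    (hmax : ∀ (t' : Fin (M + 1) → G) (p' : Fin (M + 1) → Fin (M + 1) → ι),
      μ (sepSet D μ S F A e t' p') = 0) (g : G) :
    ∀ᵐ x ∂μ, x ∈ sepSet D μ S F A e t p → (∀ i, S i g x ∈ sepSet D μ S F A e t p) →
      ∃ j, ∀ i, condSq D μ (fun y => F i y - F i (S i (t j * g) y)) x ≤ 4 * e := by
  classical
  have hFg : ∀ i g, MemLp (fun x => F i (S i g x)) 2 μ :=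
    fun i g => (hF2 i).comp_measurePreserving ((hS i).measurePreserving g)
  have hmul : ∀ i a x, S i (a * g) x = S i a (S i g x) := fun i a x =>
    (congrFun ((hS i).comp a g) x).symm
  have hone : ∀ᵐ x ∂μ, ∀ i, S i 1 x ∈ A ↔ x ∈ A :=
    ae_all_iff.2 fun i => (hS i).mem_one_ae (hD _ hA)
  have hc0 : ∀ᵐ x ∂μ, ∀ i j, condSq D μ (fun y => F i (S i 1 y) - F i (S i (t j * g) y)) x =
      condSq D μ (fun y => F i y - F i (S i (t j * g) y)) x := by
    refine ae_all_iff.2 fun i => ae_all_iff.2 fun j => condSq_congr ?_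
    filter_upwards [(hS i).comp_one_ae (hF i)] with x hx
    rw [hx]
  have hc1 : ∀ᵐ x ∂μ, ∀ i j l,
      condSq D μ (fun y => F i (S i (t j * g) y) - F i (S i (t l * g) y)) x =
      condSq D μ (fun y => F i (S i (t j) y) - F i (S i (t l) y)) (S i g x) := by
    refine ae_all_iff.2 fun i => ae_all_iff.2 fun j => ae_all_iff.2 fun l => ?_
    have h1 := (hS i).condSq_comp hD (hinv i) ((hFg i (t j)).sub (hFg i (t l))) g
    simp only [hmul]
    exact h1
  -- `q` prescribes the coordinates separating the new vector, put first, from the old ones; only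
  -- pattern entries `p j l` with `j < l` matter, so the others may be arbitrary
  have hq : ∀ q : Fin M → ι, ∀ᵐ x ∂μ, x ∉ sepSet D μ S F A e (Fin.cons 1 fun j => t j * g)
      (Fin.cons (Fin.cons (Classical.arbitrary ι) q)
        fun j => Fin.cons (Classical.arbitrary ι) (p j)) :=
    fun q => by simpa [ae_iff] using hmax _ _
  filter_upwards [hone, hc0, hc1, ae_all_iff.2 hq] with x h1 h2 h3 h4 hx hgx
  by_contra! hcon
  choose q hq using hcon
  refine h4 q ⟨hx.1, fun i j => ?_, fun j l hjl => ?_⟩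
  · refine Fin.cases ?_ (fun j => ?_) j
    · exact (h1 i).2 hx.1
    · rw [Fin.cons_succ, hmul]
      exact (hgx i).2.1 i j
  · obtain ⟨l, rfl⟩ := Fin.exists_succ_eq.2 (Fin.ne_zero_of_lt hjl)
    revert hjl
    refine Fin.cases (fun _ => ?_) (fun j hjl => ?_) j
    · simp only [Fin.cons_zero, Fin.cons_succ]
      rw [h2]
      exact hq l
    · simp only [Fin.cons_succ]
      rw [h3]
      exact (hgx (p j l)).2.2 j l (Fin.succ_lt_succ_iff.1 hjl)

/-- If the orbits of the `F i` are fibrewise totally bounded over `A`, there are a set `A' ∈ D` of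
positive measure and finitely many `t j ∈ G` such that, whenever `x ∈ A'` is returned to `A'` by
all `S i g`, some `t j * g` almost fixes all the `F i` on the fibre of `x`. -/
theorem exists_returning_set [Nonempty ι] [IsProbabilityMeasure μ]
    (hS : ∀ i, IsMeasurableAction μ (S i)) (hD : D ≤ mX)
    (hinv : ∀ i, IsInvariantSigmaAlgebra (S i) D) (hF : ∀ i, Measurable (F i))
    (hF2 : ∀ i, MemLp (F i) 2 μ) (hA : MeasurableSet[D] A) (hApos : 0 < μ A)
    (Ξ : ι → Finset (Lp ℝ ∞ μ))
    (hΞ : ∀ i g, ∀ᵐ x ∂μ, x ∈ A → S i g x ∈ A →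
      ∃ ξ ∈ Ξ i, condSq D μ (fun y => F i (S i g y) - ξ y) x ≤ e) :
    ∃ (A' : Set X) (M : ℕ) (t : Fin M → G), A' ⊆ A ∧ MeasurableSet[D] A' ∧ 0 < μ A' ∧
      ∀ g, ∀ᵐ x ∂μ, x ∈ A' → (∀ i, S i g x ∈ A') →
        ∃ j, ∀ i, condSq D μ (fun y => F i y - F i (S i (t j * g) y)) x ≤ 4 * e := by
  classical
  have hex : ∃ n, ¬ ∃ (t : Fin n → G) (p : Fin n → Fin n → ι), 0 < μ (sepSet D μ S F A e t p) :=
    ⟨(∏ i, (Ξ i).card) + 1, fun ⟨t, p, h⟩ =>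
      absurd (card_le_of_sepSet_pos hS hF2 Ξ hΞ t p h) (by omega)⟩
  have hspec := Nat.find_spec hex
  have hmin : ∀ {n}, n < Nat.find hex → _ := fun h => Nat.find_min hex h
  obtain ⟨M, hM⟩ : ∃ M, Nat.find hex = M + 1 := by
    refine Nat.exists_eq_succ_of_ne_zero fun h0 => ?_
    rw [h0] at hspec
    refine hspec ⟨Fin.elim0, Fin.elim0, ?_⟩
    convert hApos using 2
    ext x
    simp [sepSet]
  rw [hM] at hspec
  obtain ⟨t, p, hpos⟩ := not_not.1 (hmin (n := M) (by omega))
  push Not at hspec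
  refine ⟨sepSet D μ S F A e t p, M, t, fun x hx => hx.1, measurableSet_sepSet hinv hA t p, hpos,
    ae_exists_condSq_le_of_maximal hS hD hinv hF hF2 hA t p fun t' p' => ?_⟩
  exact le_antisymm (hspec t' p') bot_le

end Separated

/-! ### Multiple correlations -/

theorem prod_sub_sum_abs_le_prod {ι : Type*} (s : Finset ι) {a b : ι → ℝ}
    (ha0 : ∀ i, 0 ≤ a i) (ha1 : ∀ i, a i ≤ 1) (hb0 : ∀ i, 0 ≤ b i) (hb1 : ∀ i, b i ≤ 1) :
    ∏ i ∈ s, a i - ∑ i ∈ s, |a i - b i| ≤ ∏ i ∈ s, b i := by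
  classical
  induction s using Finset.induction_on with
  | empty => simp
  | insert i s hi ih =>
    rw [Finset.prod_insert hi, Finset.prod_insert hi, Finset.sum_insert hi]
    have hP0 : 0 ≤ ∏ i ∈ s, a i := Finset.prod_nonneg fun i _ => ha0 i
    have hP1 : ∏ i ∈ s, a i ≤ 1 := Finset.prod_le_one (fun i _ => ha0 i) fun i _ => ha1 i
    have hs : 0 ≤ ∑ i ∈ s, |a i - b i| := Finset.sum_nonneg fun i _ => abs_nonneg _
    have h1 : (a i - b i) * ∏ i ∈ s, a i ≤ |a i - b i| :=
      (mul_le_mul_of_nonneg_right (le_abs_self _) hP0).trans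
        (mul_le_of_le_one_right (abs_nonneg _) hP1)
    have h2 := mul_le_mul_of_nonneg_left ih (hb0 i)
    have h3 := mul_le_of_le_one_left hs (hb1 i)
    nlinarith

/-- On a set `C ∈ D` over which `∏ F i` correlates with `f` and every `a i` is close to `F i` on the
fibres, `∏ a i` still correlates with `f`. Integrating over `C` allows the inequality
`|u| ≤ (δ + u² / δ) / 2` to take the place of the Cauchy–Schwarz inequality on the fibres. -/
theorem mul_measureReal_le_integral_mul_prod {ι X : Type*} [Fintype ι] {D mX : MeasurableSpace X}
    {μ : Measure X} [IsProbabilityMeasure μ] (hD : D ≤ mX) {f : X → ℝ} {F a : ι → X → ℝ}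
    (hf : Measurable f) (hf0 : ∀ x, 0 ≤ f x) (hf1 : ∀ x, f x ≤ 1)
    (hF : ∀ i, Measurable (F i)) (hF0 : ∀ i x, 0 ≤ F i x) (hF1 : ∀ i x, F i x ≤ 1)
    (ha : ∀ i, Measurable (a i)) (ha0 : ∀ i x, 0 ≤ a i x) (ha1 : ∀ i x, a i x ≤ 1)
    {C : Set X} (hC : MeasurableSet[D] C) {c e δ : ℝ} (hδ : 0 < δ)
    (hc : ∀ x ∈ C, c ≤ (μ[fun x => f x * ∏ i, F i x | D]) x)
    (he : ∀ i, ∀ x ∈ C, condSq D μ (fun y => F i y - a i y) x ≤ e) :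
    (c - Fintype.card ι * (δ / 2 + e / (2 * δ))) * μ.real C ≤ ∫ x, f x * ∏ i, a i x ∂μ := by
  have hbdd : ∀ {u : X → ℝ}, Measurable u → (∀ x, |u x| ≤ 1) → Integrable u μ := fun hu hb =>
    Integrable.of_bound hu.aestronglyMeasurable 1 (ae_of_all _ hb)
  have hprod : ∀ {b : ι → X → ℝ}, (∀ i, Measurable (b i)) → (∀ i x, 0 ≤ b i x) →
      (∀ i x, b i x ≤ 1) → Integrable (fun x => f x * ∏ i, b i x) μ := by
    intro b hb hb0 hb1
    refine hbdd (hf.mul (Finset.measurable_fun_prod _ fun i _ => hb i)) fun x => ?_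
    have h0 : 0 ≤ ∏ i, b i x := Finset.prod_nonneg fun i _ => hb0 i x
    have h1 : ∏ i, b i x ≤ 1 := Finset.prod_le_one (fun i _ => hb0 i x) fun i _ => hb1 i x
    rw [abs_of_nonneg (mul_nonneg (hf0 x) h0)]
    exact mul_le_one₀ (hf1 x) h0 h1
  have hFi := hprod hF hF0 hF1
  have hai := hprod ha ha0 ha1
  have hsq : ∀ i, Integrable (fun x => (F i x - a i x) ^ 2) μ := by
    intro i
    refine hbdd (((hF i).sub (ha i)).pow_const 2) fun x => ?_
    rw [abs_of_nonneg (sq_nonneg _), sq_le_one_iff_abs_le_one, abs_le]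
    constructor <;> linarith [hF0 i x, hF1 i x, ha0 i x, ha1 i x]
  have hpt : ∀ x, f x * ∏ i, F i x - ∑ i, (δ / 2 + (F i x - a i x) ^ 2 / (2 * δ)) ≤
      f x * ∏ i, a i x := by
    intro x
    have h1 := prod_sub_sum_abs_le_prod Finset.univ (fun i => hF0 i x) (fun i => hF1 i x)
      (fun i => ha0 i x) (fun i => ha1 i x)
    have h2 : ∀ i, |F i x - a i x| ≤ δ / 2 + (F i x - a i x) ^ 2 / (2 * δ) := by
      intro i
      rw [← sq_abs (F i x - a i x)]
      have : δ / 2 + |F i x - a i x| ^ 2 / (2 * δ) - |F i x - a i x| =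
        (δ - |F i x - a i x|) ^ 2 / (2 * δ) := by field_simp; ring
      have : 0 ≤ (δ - |F i x - a i x|) ^ 2 / (2 * δ) := by positivity
      linarith
    have h3 : ∑ i, |F i x - a i x| ≤ ∑ i, (δ / 2 + (F i x - a i x) ^ 2 / (2 * δ)) :=
      Finset.sum_le_sum fun i _ => h2 i
    have h4 : 0 ≤ ∑ i, |F i x - a i x| := Finset.sum_nonneg fun i _ => abs_nonneg _
    have h5 := mul_le_mul_of_nonneg_left h1 (hf0 x)
    have h6 := mul_le_of_le_one_left h4 (hf1 x)
    linarith
  have hI1 : c * μ.real C ≤ ∫ x in C, f x * ∏ i, F i x ∂μ := by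
    rw [← setIntegral_condExp hD hFi hC]
    exact setIntegral_ge_of_const_le_real (hD _ hC) (measure_ne_top _ _) hc
      integrable_condExp.integrableOn
  have hI2 : ∀ i, ∫ x in C, (δ / 2 + (F i x - a i x) ^ 2 / (2 * δ)) ∂μ ≤
      (δ / 2 + e / (2 * δ)) * μ.real C := by
    intro i
    have h1 : ∫ x in C, (F i x - a i x) ^ 2 ∂μ ≤ e * μ.real C := by
      rw [← setIntegral_condExp hD (hsq i) hC]
      have := setIntegral_mono_on (μ := μ) (s := C) (g := fun _ => e)
        integrable_condExp.integrableOn (integrableOn_const (measure_ne_top _ _)) (hD _ hC) (he i)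
      rwa [setIntegral_const, smul_eq_mul, mul_comm] at this
    rw [integral_add (integrable_const _) ((hsq i).div_const _).integrableOn,
      setIntegral_const, smul_eq_mul, integral_div]
    have h2 := div_le_div_of_nonneg_right h1 (by positivity : 0 ≤ 2 * δ)
    calc _ ≤ μ.real C * (δ / 2) + e * μ.real C / (2 * δ) := by linarith
      _ = _ := by ring
  have hsi : ∀ i, Integrable (fun x => δ / 2 + (F i x - a i x) ^ 2 / (2 * δ)) μ :=
    fun i => (integrable_const _).add ((hsq i).div_const _)
  have hI3 : ∫ x in C, (f x * ∏ i, F i x - ∑ i, (δ / 2 + (F i x - a i x) ^ 2 / (2 * δ))) ∂μ ≤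
      ∫ x, f x * ∏ i, a i x ∂μ := by
    refine (setIntegral_mono (hFi.sub (integrable_finsetSum _ fun i _ => hsi i)).integrableOn
      hai.integrableOn hpt).trans ?_
    exact setIntegral_le_integral hai (ae_of_all _ fun x =>
      mul_nonneg (hf0 x) (Finset.prod_nonneg fun i _ => ha0 i x))
  rw [integral_sub hFi.integrableOn (integrable_finsetSum _ fun i _ => (hsi i).integrableOn),
    integral_finsetSum _ fun i _ => (hsi i).integrableOn] at hI3
  have hI4 := Finset.sum_le_sum fun i (_ : i ∈ Finset.univ) => hI2 i
  rw [Finset.sum_const, Finset.card_univ, nsmul_eq_mul] at hI4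
  linarith

/-- The integral `∫ f ∏ᵢ S_i^g Fᵢ dμ`. -/
noncomputable def corr {ι G X : Type*} [Fintype ι] {mX : MeasurableSpace X} (μ : Measure X)
    (S : ι → G → X → X) (f : X → ℝ) (F : ι → X → ℝ) (g : G) : ℝ :=
  ∫ x, f x * ∏ i, F i (S i g x) ∂μ

theorem corr_const_mul {ι G X : Type*} [Fintype ι] {mX : MeasurableSpace X} (μ : Measure X)
    (S : ι → G → X → X) (C : ℝ) (f : X → ℝ) (F : ι → X → ℝ) (g : G) :
    corr μ S (fun x => C * f x) (fun i x => C * F i x) g =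
      C ^ (Fintype.card ι + 1) * corr μ S f F g := by
  unfold corr
  rw [← integral_const_mul]
  refine integral_congr_ae (ae_of_all _ fun x => ?_)
  simp only [Finset.prod_mul_distrib, Finset.prod_const, Finset.card_univ]
  ring

section Corr

variable {ι G X : Type*} [Fintype ι] {mX : MeasurableSpace X} {μ : Measure X}
  {S : ι → G → X → X} {f : X → ℝ} {F : ι → X → ℝ}

theorem corr_nonneg (hf0 : ∀ x, 0 ≤ f x) (hF0 : ∀ i x, 0 ≤ F i x) (g : G) :
    0 ≤ corr μ S f F g :=
  integral_nonneg fun x => mul_nonneg (hf0 x) (Finset.prod_nonneg fun i _ => hF0 i _)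

theorem corr_le_one [IsProbabilityMeasure μ] (hf0 : ∀ x, 0 ≤ f x) (hf1 : ∀ x, f x ≤ 1) (hF0 : ∀ i x, 0 ≤ F i x)
    (hF1 : ∀ i x, F i x ≤ 1) (g : G) : corr μ S f F g ≤ 1 := by
  have h : ‖corr μ S f F g‖ ≤ 1 * μ.real Set.univ := by
    refine norm_integral_le_of_norm_le_const (ae_of_all _ fun x => ?_)
    have h0 : 0 ≤ ∏ i, F i (S i g x) := Finset.prod_nonneg fun i _ => hF0 i _
    have h1 : ∏ i, F i (S i g x) ≤ 1 := Finset.prod_le_one (fun i _ => hF0 i _) fun i _ => hF1 i _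
    rw [Real.norm_of_nonneg (mul_nonneg (hf0 x) h0)]
    exact mul_le_one₀ (hf1 x) h0 h1
  rw [Real.norm_of_nonneg (corr_nonneg hf0 hF0 g)] at h
  simpa using h

variable [Group G] [MeasurableSpace G]

theorem measurable_corr [SFinite μ] (hS : ∀ i, IsMeasurableAction μ (S i)) (hf : Measurable f)
    (hF : ∀ i, Measurable (F i)) : Measurable (corr μ S f F) := by
  have h1 : Measurable fun p : G × X => f p.2 * ∏ i, F i (S i p.1 p.2) :=
    (hf.comp measurable_snd).mul
      (Finset.measurable_fun_prod _ fun i _ => (hF i).comp (hS i).measurable)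
  exact (h1.stronglyMeasurable.integral_prod_right (ν := μ)).measurable

theorem corr_congr (hS : ∀ i, IsMeasurableAction μ (S i)) {f' : X → ℝ} {F' : ι → X → ℝ}
    (hf : f =ᵐ[μ] f') (hF : ∀ i, F i =ᵐ[μ] F' i) : corr μ S f F = corr μ S f' F' := by
  ext g
  refine integral_congr_ae ?_
  have h1 : ∀ᵐ x ∂μ, ∀ i, F i (S i g x) = F' i (S i g x) := ae_all_iff.2 fun i =>
    ((hS i).measurePreserving g).quasiMeasurePreserving.ae_eq_comp (hF i)
  filter_upwards [hf, h1] with x h2 h3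
  simp only [h2, h3]

end Corr

/-! ### Følner averages -/

section Folner

variable {G : Type*} [Group G] [TopologicalSpace G] [IsTopologicalGroup G]
  [MeasurableSpace G] [BorelSpace G] [T2Space G]

/-- Averages of bounded functions along a left Følner sequence are asymptotically invariant under
left translation of the argument. -/
theorem IsLeftFolner.tendsto_average_mul_sub {m : Measure G} [m.IsHaarMeasure]
    {Φ : ℕ → Set G} (hΦ : IsLeftFolner m Φ) {φ : G → ℝ} (hφ : Measurable φ)
    (hφ1 : ∀ g, |φ g| ≤ 1) (s : G) :
    Tendsto (fun N => (m.real (Φ N))⁻¹ * ∫ g in Φ N, φ (s * g) ∂m -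
      (m.real (Φ N))⁻¹ * ∫ g in Φ N, φ g ∂m) atTop (𝓝 0) := by
  have hreal := (ENNReal.tendsto_toReal ENNReal.zero_ne_top).comp (hΦ.tendsto s)
  rw [ENNReal.toReal_zero] at hreal
  refine squeeze_zero_norm (fun N => ?_) hreal
  have hm : MeasurableSet (Φ N) := (hΦ.isCompact N).isClosed.measurableSet
  have hms : MeasurableSet (s • Φ N) := hm.const_smul s
  have hfin : m (Φ N) ≠ ∞ := (hΦ.isCompact N).measure_ne_top
  have hfins : m (s • Φ N) ≠ ∞ := by rwa [measure_smul]
  have hfinΔ : m (symmDiff (Φ N) (s • Φ N)) ≠ ∞ :=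
    ((measure_mono symmDiff_le_sup).trans (measure_union_le _ _)).trans_lt
      (ENNReal.add_lt_top.2 ⟨hfin.lt_top, hfins.lt_top⟩) |>.ne
  have hint : ∀ A : Set G, m A ≠ ∞ → IntegrableOn φ A m := fun A hA =>
    IntegrableOn.of_bound hA.lt_top hφ.aestronglyMeasurable 1 (ae_of_all _ hφ1)
  have hshift : ∫ g in Φ N, φ (s * g) ∂m = ∫ g in s • Φ N, φ g ∂m := by
    rw [← integral_indicator hm, ← integral_indicator hms,
      ← integral_mul_left_eq_self ((s • Φ N).indicator φ) s]
    refine integral_congr_ae (ae_of_all _ fun g => ?_)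
    by_cases hg : g ∈ Φ N
    · have : s * g ∈ s • Φ N := Set.smul_mem_smul_set hg
      simp only [Set.indicator_of_mem hg, Set.indicator_of_mem this]
    · have : s * g ∉ s • Φ N := fun h => hg (Set.smul_mem_smul_set_iff.1 h)
      simp only [Set.indicator_of_notMem hg, Set.indicator_of_notMem this]
  have hdiff : |∫ g in s • Φ N, φ g ∂m - ∫ g in Φ N, φ g ∂m| ≤
      m.real (symmDiff (Φ N) (s • Φ N)) := by
    rw [← integral_indicator hm, ← integral_indicator hms, ← integral_sub
      ((integrable_indicator_iff hms).2 (hint _ hfins))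
      ((integrable_indicator_iff hm).2 (hint _ hfin))]
    have h1 := norm_integral_le_of_norm_le (μ := m)
      (f := fun g => (s • Φ N).indicator φ g - (Φ N).indicator φ g)
      (g := (symmDiff (Φ N) (s • Φ N)).indicator fun _ => (1 : ℝ))
      ((integrable_indicator_iff (hm.symmDiff hms)).2 (integrableOn_const hfinΔ))
      (ae_of_all _ fun g => by
        have := hφ1 g
        by_cases h1 : g ∈ Φ N <;> by_cases h2 : g ∈ s • Φ N <;>
          simp [Set.indicator, Set.mem_symmDiff, h1, h2, this])
    rw [integral_indicator (hm.symmDiff hms), setIntegral_const] at h1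
    simpa using h1
  rw [← mul_sub, hshift, norm_mul, Real.norm_eq_abs, Real.norm_eq_abs,
    abs_of_nonneg (inv_nonneg.2 measureReal_nonneg)]
  simp only [Function.comp_apply, ENNReal.toReal_div]
  rw [div_eq_inv_mul]
  exact mul_le_mul_of_nonneg_left hdiff (inv_nonneg.2 measureReal_nonneg)

end Folner

/-! ### Lifting positivity -/

section Lifting

variable {ι G X : Type*} [Fintype ι] [Nonempty ι] [Group G] [MeasurableSpace G]
  {D mX : MeasurableSpace X} {μ : Measure X} [IsProbabilityMeasure μ] {S : ι → G → X → X}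
  {f : X → ℝ} {F : ι → X → ℝ}

/-- If the orbits of the `F i` are fibrewise totally bounded over large sets in `D` and
`∫ f ∏ F i > 0`, then finitely many left translates of the correlation sequence together dominate a
multiple of the measure of simultaneous returns to a set `A ∈ D` of positive measure. -/
theorem exists_mul_measureReal_le_sum_corr (hS : ∀ i, IsMeasurableAction μ (S i)) (hD : D ≤ mX)
    (hinv : ∀ i, IsInvariantSigmaAlgebra (S i) D)
    (hf : Measurable f) (hf0 : ∀ x, 0 ≤ f x) (hf1 : ∀ x, f x ≤ 1)
    (hF : ∀ i, Measurable (F i)) (hF0 : ∀ i x, 0 ≤ F i x) (hF1 : ∀ i x, F i x ≤ 1)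
    (hpos : 0 < ∫ x, f x * ∏ i, F i x ∂μ)
    (hcover : ∀ i, ∀ e > 0, ∀ η > 0, ∃ (Ξ : Finset (Lp ℝ ∞ μ)) (A : Set X),
      MeasurableSet[D] A ∧ 1 - η < μ.real A ∧ ∀ g, ∀ᵐ x ∂μ, x ∈ A → S i g x ∈ A →
        ∃ ξ ∈ Ξ, condSq D μ (fun y => F i (S i g y) - ξ y) x ≤ e) :
    ∃ (A : Set X) (M : ℕ) (t : Fin M → G) (c : ℝ), MeasurableSet[D] A ∧ 0 < μ A ∧ 0 < c ∧
      ∀ g, c * μ.real (A ∩ ⋂ i, S i g ⁻¹' A) ≤ ∑ j, corr μ S f F (t j * g) := by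
  classical
  set W := μ[fun x => f x * ∏ i, F i x | D] with hW
  set c : ℝ := (∫ x, f x * ∏ i, F i x ∂μ) / 2 with hcdef
  have hc : 0 < c := by positivity
  have hF2 : ∀ i, MemLp (F i) 2 μ := fun i =>
    MemLp.of_bound (hF i).aestronglyMeasurable 1
      (ae_of_all _ fun x => by rw [Real.norm_of_nonneg (hF0 i x)]; exact hF1 i x)
  set A₁ : Set X := {x | c < W x} with hA₁
  have hA₁D : MeasurableSet[D] A₁ :=
    (stronglyMeasurable_condExp (m := D)).measurable measurableSet_Ioi
  have hA₁pos : 0 < μ.real A₁ := by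
    refine ENNReal.toReal_pos (fun h0 => ?_) (measure_ne_top _ _)
    have hle : ∀ᵐ x ∂μ, W x ≤ c := by
      have : ∀ᵐ x ∂μ, x ∉ A₁ := by simpa [ae_iff] using h0
      filter_upwards [this] with x hx
      exact not_lt.1 hx
    have h1 : ∫ x, W x ∂μ ≤ ∫ _, c ∂μ :=
      integral_mono_ae integrable_condExp (integrable_const c) hle
    rw [integral_condExp hD, integral_const, probReal_univ, one_smul] at h1
    linarith
  set K : ℝ := (Fintype.card ι : ℝ) with hK
  have hK0 : 0 ≤ K := Nat.cast_nonneg _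
  -- with `e = δ² / 4` the error `K * (δ / 2 + 4 * e / (2 * δ))` is `K * δ ≤ c / 2`
  set δ : ℝ := c / (2 * (K + 1)) with hδdef
  have hδ : 0 < δ := by positivity
  have hKδ : K * (δ / 2 + 4 * (δ ^ 2 / 4) / (2 * δ)) ≤ c / 2 := by
    have h1 : K * (δ / 2 + 4 * (δ ^ 2 / 4) / (2 * δ)) = K * δ := by field_simp; ring
    have h2 : c / 2 = (K + 1) * δ := by rw [hδdef]; field_simp
    rw [h1, h2]
    nlinarith
  choose Ξ A hAD hAμ hAcov using fun i => hcover i (δ ^ 2 / 4) (by positivity)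
    (μ.real A₁ / (K + 1)) (by positivity)
  set A₀ : Set X := A₁ ∩ ⋂ i, A i with hA₀
  have hA₀D : MeasurableSet[D] A₀ :=
    @MeasurableSet.inter _ D _ _ hA₁D (@MeasurableSet.iInter _ _ D _ _ hAD)
  have hA₀pos : 0 < μ A₀ := by
    have h1 : A₁ ⊆ A₀ ∪ ⋃ i, (A i)ᶜ := by
      intro x hx
      by_cases h : ∀ i, x ∈ A i
      · exact Or.inl ⟨hx, Set.mem_iInter.2 h⟩
      · push Not at h
        exact Or.inr (Set.mem_iUnion.2 h)
    have h2 : μ.real A₁ ≤ μ.real A₀ + ∑ i, μ.real (A i)ᶜ :=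
      (measureReal_mono h1).trans ((measureReal_union_le _ _).trans
        (add_le_add_right (measureReal_iUnion_fintype_le _) _))
    have h3 : ∑ i, μ.real (A i)ᶜ ≤ ∑ _i : ι, μ.real A₁ / (K + 1) :=
      Finset.sum_le_sum fun i _ => by
        have := probReal_compl_eq_one_sub (μ := μ) (hD _ (hAD i))
        linarith [hAμ i]
    rw [Finset.sum_const, Finset.card_univ, nsmul_eq_mul, ← hK] at h3
    have h4 : K * (μ.real A₁ / (K + 1)) < μ.real A₁ := by
      rw [← mul_div_assoc, div_lt_iff₀ (by positivity)]
      nlinarith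
    have h5 : 0 < μ.real A₀ := by linarith
    exact (ENNReal.toReal_pos_iff.1 h5).1
  obtain ⟨B, M, t, hBA, hBD, hBpos, hB⟩ := exists_returning_set (e := δ ^ 2 / 4) hS hD hinv hF hF2
    hA₀D hA₀pos Ξ fun i g => by
      filter_upwards [hAcov i g] with x hx h1 h2
      exact hx (Set.mem_iInter.1 h1.2 i) (Set.mem_iInter.1 h2.2 i)
  refine ⟨B, M, t, c / 2, hBD, hBpos, by positivity, fun g => ?_⟩
  set R : Set X := B ∩ ⋂ i, S i g ⁻¹' B with hR
  have hRD : MeasurableSet[D] R :=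
    @MeasurableSet.inter _ D _ _ hBD (@MeasurableSet.iInter _ _ D _ _ fun i => hinv i g B hBD)
  set C : Fin M → Set X := fun j => R ∩
    {x | ∀ i, condSq D μ (fun y => F i y - F i (S i (t j * g) y)) x ≤ 4 * (δ ^ 2 / 4)} with hCdef
  have hCD : ∀ j, MeasurableSet[D] (C j) := by
    intro j
    refine @MeasurableSet.inter _ D _ _ hRD ?_
    simp only [Set.ofPred_forall]
    exact @MeasurableSet.iInter _ _ D _ _ fun i => measurable_condSq (D := D) (μ := μ)
      (fun y => F i y - F i (S i (t j * g) y)) measurableSet_Iic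
  have hRC : μ.real R ≤ ∑ j, μ.real (C j) := by
    refine le_trans ?_ (measureReal_iUnion_fintype_le C)
    refine ENNReal.toReal_mono (measure_ne_top _ _) (measure_mono_ae ?_)
    filter_upwards [hB g] with x hx hxR
    obtain ⟨j, hj⟩ := hx hxR.1 (Set.mem_iInter.1 hxR.2)
    exact Set.mem_iUnion.2 ⟨j, hxR, hj⟩
  have hCc : ∀ j, c / 2 * μ.real (C j) ≤ corr μ S f F (t j * g) := by
    intro j
    have h1 := mul_measureReal_le_integral_mul_prod hD hf hf0 hf1 hF hF0 hF1
      (a := fun i x => F i (S i (t j * g) x))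
      (fun i => (hF i).comp ((hS i).measurePreserving _).measurable)
      (fun i x => hF0 i _) (fun i x => hF1 i _) (hCD j) hδ
      (fun x hx => (hBA hx.1.1).1.le) (fun i x hx => hx.2 i)
    refine le_trans (mul_le_mul_of_nonneg_right ?_ measureReal_nonneg) h1
    linarith
  calc c / 2 * μ.real R ≤ c / 2 * ∑ j, μ.real (C j) :=
        mul_le_mul_of_nonneg_left hRC (by positivity)
    _ = ∑ j, c / 2 * μ.real (C j) := Finset.mul_sum _ _ _
    _ ≤ _ := Finset.sum_le_sum fun j _ => hCc j

end Lifting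

/-- Positivity of the averages of the return measures of sets in `D` lifts to positivity of the
averages of `∫ f ∏ᵢ S_i^g Fᵢ dμ`. -/
theorem exists_eventually_le_average_corr {ι G X : Type*} [Fintype ι] [Nonempty ι] [Group G]
    [TopologicalSpace G] [IsTopologicalGroup G] [T2Space G] [MeasurableSpace G] [BorelSpace G]
    {m : Measure G} [m.IsHaarMeasure] {Φ : ℕ → Set G} (hΦ : IsLeftFolner m Φ)
    {mX : MeasurableSpace X} {μ : Measure X} [IsProbabilityMeasure μ] {S : ι → G → X → X}
    (hS : ∀ i, IsMeasurableAction μ (S i)) {f : X → ℝ} {F : ι → X → ℝ}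
    (hf : Measurable f) (hf0 : ∀ x, 0 ≤ f x) (hf1 : ∀ x, f x ≤ 1)
    (hF : ∀ i, Measurable (F i)) (hF0 : ∀ i x, 0 ≤ F i x) (hF1 : ∀ i x, F i x ≤ 1)
    {A : Set X} (hA : MeasurableSet A) {M : ℕ} (t : Fin M → G) {c c₀ : ℝ} (hc : 0 < c)
    (hc₀ : 0 < c₀)
    (hcorr : ∀ g, c * μ.real (A ∩ ⋂ i, S i g ⁻¹' A) ≤ ∑ j, corr μ S f F (t j * g))
    (hbase : ∀ᶠ N in atTop, c₀ ≤
      (m.real (Φ N))⁻¹ * ∫ g in Φ N, μ.real (A ∩ ⋂ i, S i g ⁻¹' A) ∂m) :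
    ∃ c > 0, ∀ᶠ N in atTop, c ≤ (m.real (Φ N))⁻¹ * ∫ g in Φ N, corr μ S f F g ∂m := by
  set φ := corr μ S f F with hφdef
  have hφm : Measurable φ := measurable_corr hS hf hF
  have hφ0 : ∀ g, 0 ≤ φ g := corr_nonneg hf0 hF0
  have hφ1 : ∀ g, |φ g| ≤ 1 := fun g => by
    rw [abs_of_nonneg (hφ0 g)]; exact corr_le_one hf0 hf1 hF0 hF1 g
  have hψm : Measurable fun g => μ.real (A ∩ ⋂ i, S i g ⁻¹' A) := by
    have h1 : MeasurableSet {p : G × X | p.2 ∈ A ∩ ⋂ i, S i p.1 ⁻¹' A} := by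
      have h2 : {p : G × X | p.2 ∈ A ∩ ⋂ i, S i p.1 ⁻¹' A} =
          Prod.snd ⁻¹' A ∩ ⋂ i, (fun p : G × X => S i p.1 p.2) ⁻¹' A := by
        ext p; simp
      rw [h2]
      exact (measurable_snd hA).inter (MeasurableSet.iInter fun i => (hS i).measurable hA)
    exact (measurable_measure_prodMk_left h1).ennreal_toReal
  have hfin : ∀ N, m (Φ N) < ∞ := fun N => (hΦ.isCompact N).measure_lt_top
  have hφi : ∀ N s, IntegrableOn (fun g => φ (s * g)) (Φ N) m := fun N s =>
    IntegrableOn.of_bound (hfin N) (hφm.comp (measurable_const_mul s)).aestronglyMeasurable 1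
      (ae_of_all _ fun g => hφ1 _)
  have hψi : ∀ N, IntegrableOn (fun g => μ.real (A ∩ ⋂ i, S i g ⁻¹' A)) (Φ N) m := fun N =>
    IntegrableOn.of_bound (hfin N) hψm.aestronglyMeasurable 1 (ae_of_all _ fun g => by
      rw [Real.norm_of_nonneg measureReal_nonneg]; exact measureReal_le_one)
  have hlim := tendsto_finsetSum Finset.univ fun j _ => hΦ.tendsto_average_mul_sub hφm hφ1 (t j)
  rw [Finset.sum_const_zero] at hlim
  refine ⟨c * c₀ / (2 * (M + 1)), by positivity, ?_⟩
  filter_upwards [hbase, hlim.eventually_lt_const (show 0 < c * c₀ / 2 by positivity)] with N h1 h2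
  set u := (m.real (Φ N))⁻¹ * ∫ g in Φ N, φ g ∂m with hu
  have hu0 : 0 ≤ u := mul_nonneg (inv_nonneg.2 measureReal_nonneg)
    (integral_nonneg fun g => hφ0 g)
  rw [Finset.sum_sub_distrib, Finset.sum_const, Finset.card_univ, Fintype.card_fin,
    nsmul_eq_mul, ← Finset.mul_sum, ← integral_finsetSum _ fun j _ => hφi N (t j)] at h2
  have h3 : c * ∫ g in Φ N, μ.real (A ∩ ⋂ i, S i g ⁻¹' A) ∂m ≤
      ∫ g in Φ N, ∑ j, φ (t j * g) ∂m := by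
    rw [← integral_const_mul]
    exact integral_mono ((hψi N).const_mul c) (integrable_finsetSum _ fun j _ => hφi N (t j)) hcorr
  have h4 := mul_le_mul_of_nonneg_left h3 (inv_nonneg.2 (measureReal_nonneg (μ := m) (s := Φ N)))
  have h5 := mul_le_mul_of_nonneg_left h1 hc.le
  rw [div_le_iff₀ (by positivity)]
  nlinarith

/-! ### Positivity for conditional expectations -/

/-- A nonnegative bounded function is positively correlated with the product of its conditional
expectations, because these are positive wherever it is. -/
theorem integral_mul_prod_condExp_pos {ι X : Type*} [Fintype ι] {mX : MeasurableSpace X}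
    {μ : Measure X} [IsProbabilityMeasure μ] {E : ι → MeasurableSpace X} (hE : ∀ i, E i ≤ mX)
    {f : X → ℝ} (hf : Integrable f μ) (hf0 : 0 ≤ᵐ[μ] f) (hne : ¬ f =ᵐ[μ] 0)
    {h : X → ℝ} {F : ι → X → ℝ} (hh0 : 0 ≤ᵐ[μ] h) (hF0 : ∀ i, 0 ≤ᵐ[μ] F i)
    (hh : ∀ᵐ x ∂μ, 0 < f x → 0 < h x) (hF : ∀ i, ∀ᵐ x ∂μ, 0 < (μ[f | E i]) x → 0 < F i x)
    (hint : Integrable (fun x => h x * ∏ i, F i x) μ) :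
    0 < ∫ x, h x * ∏ i, F i x ∂μ := by
  have hF0' := ae_all_iff.2 hF0
  have hnn : 0 ≤ᵐ[μ] fun x => h x * ∏ i, F i x := by
    filter_upwards [hh0, hF0'] with x h1 h2
    exact mul_nonneg h1 (Finset.prod_nonneg fun i _ => h2 i)
  refine lt_of_le_of_ne (integral_nonneg_of_ae hnn) fun h0 => hne ?_
  have hz := (integral_eq_zero_iff_of_nonneg_ae hnn hint).1 h0.symm
  have hEpos : ∀ i, ∀ᵐ x ∂μ, 0 < f x → 0 < (μ[f | E i]) x := by
    intro i
    set Z : Set X := {x | (μ[f | E i]) x ≤ 0} with hZ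
    have hm : Measurable[E i] (μ[f | E i]) := stronglyMeasurable_condExp.measurable
    have hZE : MeasurableSet[E i] Z := hm measurableSet_Iic
    have h1 : ∫ x in Z, f x ∂μ ≤ 0 := by
      rw [← setIntegral_condExp (hE i) hf hZE]
      exact setIntegral_nonpos (hE i _ hZE) fun x hx => hx
    have h2 : 0 ≤ᵐ[μ.restrict Z] f := ae_restrict_of_ae hf0
    have h3 := (integral_eq_zero_iff_of_nonneg_ae h2 hf.integrableOn).1
      (le_antisymm h1 (integral_nonneg_of_ae h2))
    filter_upwards [(ae_restrict_iff' (hE i _ hZE)).1 h3] with x hx hfx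
    by_contra hcon
    exact hfx.ne' (hx (not_lt.1 hcon))
  filter_upwards [hf0, hz, hh, ae_all_iff.2 hF, ae_all_iff.2 hEpos] with x h1 h2 h3 h4 h5
  by_contra hne
  have hfx : 0 < f x := lt_of_le_of_ne h1 (Ne.symm hne)
  have := mul_pos (h3 hfx) (Finset.prod_pos fun i _ => h4 i (h5 i hfx) : 0 < ∏ i, F i x)
  exact this.ne' h2

/-- The positivity hypothesis for `D`, applied to the indicator function of `A ∈ D`. -/
theorem exists_eventually_le_average_return {G X : Type*} [Group G] [MeasurableSpace G]
    {m : Measure G} {Φ : ℕ → Set G} {D mX : MeasurableSpace X} {μ : Measure X}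
    [IsProbabilityMeasure μ] {k : ℕ} {T : Fin k → G → X → X}
    (hS : ∀ i, IsMeasurableAction μ (tailAction T i)) (hD : D ≤ mX)
    (hpos : ∀ f : Lp ℝ ∞ μ, 0 < f →
      0 < liminf (fun N => multipleAverage m μ T (Φ N) f (fun _ => μ[f | D])) atTop)
    {A : Set X} (hA : MeasurableSet[D] A) (hA0 : 0 < μ A) :
    ∃ c > 0, ∀ᶠ N in atTop, c ≤
      (m.real (Φ N))⁻¹ * ∫ g in Φ N, μ.real (A ∩ ⋂ i, tailAction T i g ⁻¹' A) ∂m := by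
  set f : Lp ℝ ∞ μ := indicatorConstLp ∞ (hD _ hA) (measure_ne_top μ A) (1 : ℝ) with hf
  have hfA : f =ᵐ[μ] A.indicator fun _ => (1 : ℝ) := indicatorConstLp_coeFn
  have hf0 : 0 < f := by
    refine lt_of_le_of_ne ((Lp.coeFn_nonneg f).1 ?_) fun h0 => hA0.ne' ?_
    · filter_upwards [hfA] with x hx
      rw [hx]
      exact Set.indicator_nonneg (fun _ _ => zero_le_one) x
    · have h1 : (f : X → ℝ) =ᵐ[μ] 0 := by rw [← h0]; exact Lp.coeFn_zero _ _ _
      have h2 : ∀ᵐ x ∂μ, x ∉ A := by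
        filter_upwards [h1, hfA] with x hx1 hx2 hxA
        rw [hx1, Set.indicator_of_mem hxA] at hx2
        exact zero_ne_one hx2
      simpa [ae_iff] using h2
  have hcond : μ[f | D] =ᵐ[μ] A.indicator fun _ => (1 : ℝ) := by
    refine (condExp_congr_ae hfA).trans (Eq.eventuallyEq ?_)
    have hm : StronglyMeasurable[D] (A.indicator fun _ => (1 : ℝ)) :=
      StronglyMeasurable.indicator stronglyMeasurable_const hA
    exact condExp_of_stronglyMeasurable hD hm ((integrable_const 1).indicator (hD _ hA))
  have hcorr : corr μ (tailAction T) f (fun _ => μ[f | D]) =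
      fun g => μ.real (A ∩ ⋂ i, tailAction T i g ⁻¹' A) := by
    rw [corr_congr hS hfA (fun _ => hcond)]
    ext g
    have hmeas : MeasurableSet (A ∩ ⋂ i, tailAction T i g ⁻¹' A) :=
      (hD _ hA).inter (MeasurableSet.iInter fun i =>
        ((hS i).measurePreserving g).measurable (hD _ hA))
    rw [← integral_indicator_one hmeas]
    refine integral_congr_ae (ae_of_all _ fun x => ?_)
    by_cases hx : x ∈ A ∩ ⋂ i, tailAction T i g ⁻¹' A
    · have h1 : ∀ i, tailAction T i g x ∈ A := Set.mem_iInter.1 hx.2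
      simp [Set.indicator, hx.1, h1]
    · rw [Set.indicator_of_notMem hx]
      dsimp only
      by_cases hxA : x ∈ A
      · obtain ⟨i, hi⟩ : ∃ i, tailAction T i g x ∉ A := by
          by_contra! hcon
          exact hx ⟨hxA, Set.mem_iInter.2 hcon⟩
        rw [Finset.prod_eq_zero (Finset.mem_univ i) (Set.indicator_of_notMem hi _), mul_zero]
      · rw [Set.indicator_of_notMem hxA, zero_mul]
  have havg : ∀ N, multipleAverage m μ T (Φ N) f (fun _ => μ[f | D]) =
      (m.real (Φ N))⁻¹ * ∫ g in Φ N, μ.real (A ∩ ⋂ i, tailAction T i g ⁻¹' A) ∂m := fun N => by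
    rw [← hcorr]; rfl
  have hlim := hpos f hf0
  simp only [havg] at hlim
  obtain ⟨c, hc0, hc⟩ := exists_between hlim
  refine ⟨c, hc0, (eventually_lt_of_lt_liminf hc ?_).mono fun N hN => hN.le⟩
  exact isBoundedUnder_of ⟨0, fun N => mul_nonneg (inv_nonneg.2 measureReal_nonneg)
    (integral_nonneg fun g => measureReal_nonneg)⟩

theorem mainTheorem4
    {G : Type*} [Group G] [TopologicalSpace G] [IsTopologicalGroup G] [LocallyCompactSpace G]
    [SecondCountableTopology G] [T2Space G] [MeasurableSpace G] [BorelSpace G]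
    (m : Measure G) [m.IsHaarMeasure]
    (Γ : Subgroup G) (hΓ : (Γ : Set G).Countable) (hΓd : Dense (Γ : Set G))
    (Φ : ℕ → Set G) (hΦ : IsLeftFolner m Φ)
    {X : Type*} [mX : MeasurableSpace X] [MeasurableSpace.CountablyGenerated X]
    [MeasurableSpace.SeparatesPoints X] (μ : Measure X) [IsProbabilityMeasure μ]
    {k : ℕ} (T : Fin k → G → X → X)
    (hT : ∀ i, IsMeasurableAction μ (T i)) (hcomm : ActionsCommute T)
    (D : MeasurableSpace X) (hD : D ≤ mX)
    (hDinv : ∀ i, IsInvariantSigmaAlgebra (tailAction T i) D)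
    (hpos : ∀ f : Lp ℝ ∞ μ, 0 < f →
      0 < liminf (fun N => multipleAverage m μ T (Φ N) f (fun _ => μ[f | D])) atTop)
    (E : Fin k → MeasurableSpace X) (hE : ∀ i, E i ≤ mX)
    (hEinv : ∀ i, IsInvariantSigmaAlgebra (tailAction T i) (E i))
    (hcompact : ∀ i, IsCompactExtension Γ (tailAction T i) (E i) D μ) :
    ∀ f : Lp ℝ ∞ μ, 0 < f →
      0 < liminf (fun N => multipleAverage m μ T (Φ N) f (fun i => μ[f | E i])) atTop := by
  intro f hf
  rcases Nat.eq_zero_or_pos k with rfl | hk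
  · -- both averages are `∫ f dμ`, the products being empty
    have h := hpos f hf
    unfold multipleAverage at h ⊢
    simpa only [Finset.univ_eq_empty, Finset.prod_empty] using h
  have : Nonempty (Fin k) := ⟨⟨0, hk⟩⟩
  have hS : ∀ i, IsMeasurableAction μ (tailAction T i) :=
    isMeasurableAction_tailAction hT hcomm
  have hf0 : 0 ≤ᵐ[μ] f := (Lp.coeFn_nonneg f).2 hf.le
  have hfi : Integrable f μ := (Lp.memLp f).integrable le_top
  have hfne : ¬ (f : X → ℝ) =ᵐ[μ] 0 := fun h =>
    hf.ne' (Lp.ext (h.trans (Lp.coeFn_zero _ _ _).symm))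
  -- rescale `f` and its conditional expectations to take values in `[0, 1]` everywhere
  set C : ℝ := lpNorm f ∞ μ + 1 with hCdef
  have hC : 0 < C := by have : 0 ≤ lpNorm f ∞ μ := lpNorm_nonneg; linarith
  have hfC : ∀ᵐ x ∂μ, |f x| ≤ C := by
    filter_upwards [ae_le_lpNorm_exponent_top (Lp.memLp f)] with x hx
    rw [← Real.norm_eq_abs]; linarith
  set r : ℝ → ℝ := fun y => max 0 (min 1 (y / C)) with hr
  have hrm : Continuous r := by fun_prop
  have hr0 : ∀ y, 0 ≤ r y := fun y => le_max_left _ _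
  have hr1 : ∀ y, r y ≤ 1 := fun y => max_le zero_le_one (min_le_left _ _)
  have hrpos : ∀ y, 0 < y → 0 < r y := fun y hy =>
    lt_max_of_lt_right (lt_min one_pos (div_pos hy hC))
  have hrC : ∀ y, 0 ≤ y → |y| ≤ C → y = C * r y := by
    intro y hy hyC
    have h1 : y / C ≤ 1 := (div_le_one hC).2 ((le_abs_self y).trans hyC)
    simp only [hr]
    rw [min_eq_right h1, max_eq_right (div_nonneg hy hC.le), mul_div_cancel₀ _ hC.ne']
  set F : Fin k → X → ℝ := fun i x => r ((μ[f | E i]) x) with hFdef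
  have hEm : ∀ i, StronglyMeasurable[E i] (F i) := fun i =>
    hrm.comp_stronglyMeasurable stronglyMeasurable_condExp
  have hFm : ∀ i, Measurable[mX] (F i) := fun i => ((hEm i).mono (hE i)).measurable
  have hfm : Measurable[mX] fun x => r (f x) :=
    hrm.measurable.comp (Lp.stronglyMeasurable f).measurable
  have hF2 : ∀ i, MemLp (F i) 2 μ := fun i =>
    MemLp.of_bound (hFm i).aestronglyMeasurable 1
      (ae_of_all _ fun x => by rw [Real.norm_of_nonneg (hr0 _)]; exact hr1 _)
  have hint : Integrable (fun x => r (f x) * ∏ i, F i x) μ := by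
    refine Integrable.of_bound
      (hfm.mul (Finset.measurable_fun_prod _ fun i _ => hFm i)).aestronglyMeasurable 1
      (ae_of_all _ fun x => ?_)
    have h0 : 0 ≤ ∏ i, F i x := Finset.prod_nonneg fun i _ => hr0 _
    rw [Real.norm_of_nonneg (mul_nonneg (hr0 _) h0)]
    exact mul_le_one₀ (hr1 _) h0 (Finset.prod_le_one (fun i _ => hr0 _) fun i _ => hr1 _)
  have hI : 0 < ∫ x, r (f x) * ∏ i, F i x ∂μ :=
    integral_mul_prod_condExp_pos hE hfi hf0 hfne (ae_of_all _ fun x => hr0 _)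
      (fun i => ae_of_all _ fun x => hr0 _) (ae_of_all _ fun x => hrpos _)
      (fun i => ae_of_all _ fun x => hrpos _) hint
  obtain ⟨A, M, t, c, hAD, hA0, hc, hcorr⟩ := exists_mul_measureReal_le_sum_corr hS hD hDinv hfm
    (fun x => hr0 _) (fun x => hr1 _) hFm (fun i x => hr0 _) (fun i x => hr1 _) hI
    (fun i e he η hη => (hcompact i).exists_cover m hΓd (hS i) hD (hF2 i) (hEm i) he hη)
  obtain ⟨c₀, hc₀, hbase⟩ := exists_eventually_le_average_return hS hD hpos hAD hA0
  obtain ⟨b, hb, hbN⟩ := exists_eventually_le_average_corr hΦ hS hfm (fun x => hr0 _)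
    (fun x => hr1 _) hFm (fun i x => hr0 _) (fun i x => hr1 _) (hD _ hAD) t hc hc₀ hcorr hbase
  have hcongr : corr μ (tailAction T) f (fun i => μ[f | E i]) = fun g =>
      C ^ (Fintype.card (Fin k) + 1) * corr μ (tailAction T) (fun x => r (f x)) F g := by
    have h1 : (f : X → ℝ) =ᵐ[μ] fun x => C * r (f x) := by
      filter_upwards [hf0, hfC] with x hx1 hx2
      exact hrC _ hx1 hx2
    have h2 : ∀ i, μ[f | E i] =ᵐ[μ] fun x => C * F i x := by
      intro i
      filter_upwards [condExp_nonneg (m := E i) hf0,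
        ae_bdd_abs_condExp_of_ae_bdd_abs (m := E i) hfC] with x hx1 hx2
      exact hrC _ hx1 hx2
    rw [corr_congr hS h1 h2]
    ext g
    exact corr_const_mul μ (tailAction T) C _ F g
  have havg : ∀ N, multipleAverage m μ T (Φ N) f (fun i => μ[f | E i]) =
      C ^ (Fintype.card (Fin k) + 1) * ((m.real (Φ N))⁻¹ *
        ∫ g in Φ N, corr μ (tailAction T) (fun x => r (f x)) F g ∂m) := fun N => by
    change (m.real (Φ N))⁻¹ * ∫ g in Φ N, corr μ (tailAction T) f (fun i => μ[f | E i]) g ∂m = _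
    rw [hcongr, integral_const_mul]
    ring
  have hle : ∀ N, (m.real (Φ N))⁻¹ *
      ∫ g in Φ N, corr μ (tailAction T) (fun x => r (f x)) F g ∂m ≤ 1 := by
    intro N
    have h1 : ‖∫ g in Φ N, corr μ (tailAction T) (fun x => r (f x)) F g ∂m‖ ≤
        1 * m.real (Φ N) :=
      norm_setIntegral_le_of_norm_le_const (hΦ.isCompact N).measure_lt_top fun g _ => by
        rw [Real.norm_of_nonneg (corr_nonneg (fun x => hr0 _) (fun i x => hr0 _) g)]
        exact corr_le_one (fun x => hr0 _) (fun x => hr1 _) (fun i x => hr0 _)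
          (fun i x => hr1 _) g
    have hm : 0 < m.real (Φ N) :=
      ENNReal.toReal_pos (hΦ.pos N).ne' (hΦ.isCompact N).measure_lt_top.ne
    rw [inv_mul_le_iff₀ hm, mul_one]
    exact (le_abs_self _).trans (by simpa using h1)
  have hCk : 0 < C ^ (Fintype.card (Fin k) + 1) := by positivity
  simp only [havg]
  refine lt_of_lt_of_le (mul_pos hCk hb) (le_liminf_of_le ?_
    (hbN.mono fun N hN => mul_le_mul_of_nonneg_left hN hCk.le))
  exact (isBoundedUnder_of ⟨C ^ (Fintype.card (Fin k) + 1) * 1, fun N =>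
    mul_le_mul_of_nonneg_left (hle N) hCk.le⟩).isCoboundedUnder_ge
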